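/- Let \(K\) be a compact connected Lie group with Lie algebra \(\mathfrak k\), let \(G\) be its complexification (a connected complex reductive group, with Lie algebra \(\mathfrak g=\mathfrak k\oplus i\mathfrak k\)), and let \(\phi\colon G\to \mathrm{GL}(V)\) be a rational (equivalently, holomorphic) representation on a finite-dimensional complex vector space \(V\), equipped with a \(K\)-invariant Hermitian inner product \(\langle\cdot,\cdot\rangle\) (linear in the second argument) and the induced norm \(\|\cdot\|\). Let \(\Phi\colon\mathfrak g\to\mathrm{End}(V)\) be the infinitesimal action, and for \(0\ne v\in V\) let \(\mu(v)\in(i\mathfrak k)^*\) be the moment map \[\mu(v)(X)=\frac{\langle v,\Phi(X)v\rangle}{\|v\|^2}\qquad(X\in i\mathfrak k).\] Let \(K_{[v]}=\{u\in K:\phi(u)\,\mathbb Cv=\mathbb Cv\}\) be the stabilizer of the point \([v]\in\mathbb P(V)\). For \(k\in\mathbb N\), equip \(V^{\otimes k}\) with the inner product induced from \(V\), and let \(\Pi_k\) be the orthogonal projection of \(V^{\otimes k}\) onto its subspace of \(G\)-invariant vectors. Let \(v\in V\) be a unit vector with \(\mu(v)=0\). Then there exists an integer \(m>0\) such that the limit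 \[\lim_{k\to\infty}\,(mk)^{(\dim K-\dim K_{[v]})/2}\,\bigl\|\Pi_{mk}v^{\otimes mk}\bigr\|^2\] exists and is positive. -/

import Mathlib

open Filter Topology
open scoped Manifold ContDiff TensorProduct

noncomputable section

/-! ### Tensor powers of a Hermitian space -/

section TensorPowers

variable (V : Type*) [NormedAddCommGroup V] [InnerProductSpace ℂ V] [FiniteDimensional ℂ V]

/-- The `k`-th tensor power of `V`. This is a synonym of Mathlib's `⨂[ℂ]^k V`, which will carry the
Hermitian inner product induced from `V`. -/
def HTensorPower (k : ℕ) : Type _ := ⨂[ℂ]^k V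

instance (k : ℕ) : AddCommGroup (HTensorPower V k) := inferInstanceAs (AddCommGroup (⨂[ℂ]^k V))

instance (k : ℕ) : Module ℂ (HTensorPower V k) := inferInstanceAs (Module ℂ (⨂[ℂ]^k V))

/-- The basis of the tensor power formed by the tensor products of the vectors of an
orthonormal basis of `V`. -/
def HTensorPower.stdBasis (k : ℕ) :
    Module.Basis (Fin k → Fin (Module.finrank ℂ V)) ℂ (HTensorPower V k) :=
  Basis.piTensorProduct fun _ : Fin k => (stdOrthonormalBasis ℂ V).toBasis

/-- The canonical inner product on the tensor power, defined by declaring the tensor products of the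
vectors of an orthonormal basis of `V` to be orthonormal. By `HTensorPower.inner_tprod` below,
it is the inner product with `⟪x₁ ⊗ ⋯ ⊗ x_k, y₁ ⊗ ⋯ ⊗ y_k⟫ = ∏ i, ⟪x_i, y_i⟫`, so it does
not depend on the orthonormal basis. -/
@[reducible]
def HTensorPower.core (k : ℕ) : InnerProductSpace.Core ℂ (HTensorPower V k) where
  inner s t := ∑ p, (starRingEnd ℂ) ((HTensorPower.stdBasis V k).repr s p) *
    (HTensorPower.stdBasis V k).repr t p
  conj_inner_symm s t := by
    simp [map_sum, mul_comm]
  re_inner_nonneg s := by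
    rw [map_sum]
    refine Finset.sum_nonneg fun p _ => ?_
    rw [RCLike.conj_mul, ← RCLike.ofReal_pow, RCLike.ofReal_re]
    positivity
  add_left s t w := by
    simp [add_mul, Finset.sum_add_distrib]
  smul_left s t c := by
    simp [Finset.mul_sum, mul_assoc]
  definite s h := by
    have h' : ∑ p, ‖(HTensorPower.stdBasis V k).repr s p‖ ^ 2 = 0 := by
      have h2 : ((∑ p, ‖(HTensorPower.stdBasis V k).repr s p‖ ^ 2 : ℝ) : ℂ) = 0 := by
        rw [← h]
        push_cast
        exact Finset.sum_congr rfl fun p _ => (RCLike.conj_mul _).symm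
      exact_mod_cast h2
    rw [Finset.sum_eq_zero_iff_of_nonneg fun _ _ => by positivity] at h'
    refine (HTensorPower.stdBasis V k).ext_elem fun p => ?_
    simpa using h' p (Finset.mem_univ p)

instance (k : ℕ) : NormedAddCommGroup (HTensorPower V k) :=
  (HTensorPower.core V k).toNormedAddCommGroup

instance (k : ℕ) : InnerProductSpace ℂ (HTensorPower V k) :=
  InnerProductSpace.ofCore (HTensorPower.core V k).toCore

instance (k : ℕ) : FiniteDimensional ℂ (HTensorPower V k) :=
  (HTensorPower.stdBasis V k).finiteDimensional_of_finite

variable {V}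

/-- The elementary tensor `x₁ ⊗ ⋯ ⊗ x_k`. -/
def HTensorPower.tprod {k : ℕ} (x : Fin k → V) : HTensorPower V k := PiTensorProduct.tprod ℂ x

theorem HTensorPower.inner_tprod {k : ℕ} (x y : Fin k → V) :
    inner ℂ (HTensorPower.tprod x) (HTensorPower.tprod y) = ∏ i, inner ℂ (x i) (y i) := by
  have h (z : Fin k → V) (p : Fin k → Fin (Module.finrank ℂ V)) :
      (HTensorPower.stdBasis V k).repr (HTensorPower.tprod z) p =
        ∏ i, inner ℂ (stdOrthonormalBasis ℂ V (p i)) (z i) := by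
    refine (Basis.piTensorProduct_repr_tprod_apply _ z p).trans ?_
    simp [OrthonormalBasis.repr_apply_apply]
  change ∑ p, (starRingEnd ℂ) ((HTensorPower.stdBasis V k).repr (HTensorPower.tprod x) p) *
    (HTensorPower.stdBasis V k).repr (HTensorPower.tprod y) p = _
  simp only [h, map_prod, inner_conj_symm, ← Finset.prod_mul_distrib]
  rw [← Fintype.prod_sum fun (i : Fin k) j =>
    inner ℂ (x i) (stdOrthonormalBasis ℂ V j) * inner ℂ (stdOrthonormalBasis ℂ V j) (y i)]
  exact Finset.prod_congr rfl fun i _ => (stdOrthonormalBasis ℂ V).sum_inner_mul_inner _ _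

/-- The tensor power `v^{⊗k}` of a vector `v`. -/
def HTensorPower.pow (v : V) (k : ℕ) : HTensorPower V k := HTensorPower.tprod fun _ => v

/-- The `k`-th tensor power of a representation: `g` acts by `φ(g) ⊗ ⋯ ⊗ φ(g)`. -/
def Representation.hTensorPower {G : Type*} [Group G] (φ : Representation ℂ G V) (k : ℕ) :
    Representation ℂ G (HTensorPower V k) where
  toFun g := PiTensorProduct.map fun _ : Fin k => φ g
  map_one' := by
    simp only [map_one]
    exact PiTensorProduct.map_one
  map_mul' g h := by
    simp only [map_mul]
    exact PiTensorProduct.map_mul _ _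

/-- The orthogonal projection `Π_k` of `V^{⊗k}` onto its subspace of `G`-invariant vectors. -/
def Representation.invariantProj {G : Type*} [Group G] (φ : Representation ℂ G V) (k : ℕ) :
    HTensorPower V k →L[ℂ] HTensorPower V k :=
  (φ.hTensorPower k).invariants.starProjection

end TensorPowers

/-! ### Compact Lie groups and their complexifications -/

section LieGroups

universe w

variable {K : Type*} [Group K]
  {G : Type*} [Group G]

/-- `ι : K → G` exhibits the complex Lie group `G` as the (universal) complexification of the
real Lie group `K`: `ι` is a smooth homomorphism, and every smooth homomorphism from `K` to a
complex Lie group `H` is the restriction along `ι` of exactly one holomorphic homomorphism from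
`G` to `H`. Complex manifolds are regarded as real ones through the same charts. -/
structure IsLieComplexification (E : Type*) [NormedAddCommGroup E] [NormedSpace ℝ E]
    {K : Type*} [TopologicalSpace K] [ChartedSpace E K] [Group K]
    (F : Type*) [NormedAddCommGroup F] [NormedSpace ℂ F]
    {G : Type w} [TopologicalSpace G] [ChartedSpace F G] [Group G] (ι : K →* G) : Prop where
  contMDiff : ContMDiff 𝓘(ℝ, E) 𝓘(ℝ, F) ∞ ι
  existsUnique_lift : ∀ (F' : Type w) [NormedAddCommGroup F'] [NormedSpace ℂ F']
    [FiniteDimensional ℂ F'] (H : Type w) [TopologicalSpace H] [ChartedSpace F' H] [Group H]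
    [LieGroup 𝓘(ℂ, F') ω H] (ρ : K →* H), ContMDiff 𝓘(ℝ, E) 𝓘(ℝ, F') ∞ ρ →
    ∃! ψ : G →* H, ContMDiff 𝓘(ℂ, F) 𝓘(ℂ, F') ω ψ ∧ ψ.comp ι = ρ

/-- The differential `𝔨 → 𝔤` at the identity of a homomorphism `ι : K → G`. -/
def lieDifferential (E : Type*) [NormedAddCommGroup E] [NormedSpace ℝ E]
    {K : Type*} [TopologicalSpace K] [ChartedSpace E K] [Group K]
    (F : Type*) [NormedAddCommGroup F] [NormedSpace ℂ F]
    {G : Type*} [TopologicalSpace G] [ChartedSpace F G] [Group G] (ι : K →* G) :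
    GroupLieAlgebra 𝓘(ℝ, E) K →ₗ[ℝ] GroupLieAlgebra 𝓘(ℂ, F) G :=
  (mfderiv 𝓘(ℝ, E) 𝓘(ℝ, F) ι 1 : E →L[ℝ] F).toLinearMap

/-- The real subspace `i𝔨` of the Lie algebra `𝔤` of `G`, where the Lie algebra `𝔨` of `K` is mapped
to `𝔤` by the differential of `ι : K → G` at the identity. -/
def iLieAlgebra (E : Type*) [NormedAddCommGroup E] [NormedSpace ℝ E]
    {K : Type*} [TopologicalSpace K] [ChartedSpace E K] [Group K]
    (F : Type*) [NormedAddCommGroup F] [NormedSpace ℂ F]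
    {G : Type*} [TopologicalSpace G] [ChartedSpace F G] [Group G] (ι : K →* G) :
    Submodule ℝ (GroupLieAlgebra 𝓘(ℂ, F) G) where
  carrier := {Z | ∃ X : GroupLieAlgebra 𝓘(ℝ, E) K, Z = Complex.I • lieDifferential E F ι X}
  zero_mem' := ⟨0, by rw [map_zero, smul_zero]⟩
  add_mem' := by
    rintro _ _ ⟨X, rfl⟩ ⟨Y, rfl⟩
    exact ⟨X + Y, by rw [map_add, smul_add]⟩
  smul_mem' := by
    rintro c _ ⟨X, rfl⟩
    exact ⟨c • X, by rw [map_smul, smul_comm]⟩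

/-- The dimension of a (closed) subgroup `S` of the Lie group `K`, i.e. the dimension of its Lie
algebra, which consists of the initial velocities of the one-parameter subgroups of `K`
that lie in `S`. (For closed `S` these velocities already form a linear subspace.) -/
def Subgroup.lieDim (E : Type*) [NormedAddCommGroup E] [NormedSpace ℝ E]
    {K : Type*} [TopologicalSpace K] [ChartedSpace E K] [Group K] (S : Subgroup K) : ℕ :=
  Module.finrank ℝ (Submodule.span ℝ {X : GroupLieAlgebra 𝓘(ℝ, E) K |
    ∃ γ : ℝ → K, (∀ s t, γ (s + t) = γ s * γ t) ∧ ContMDiff 𝓘(ℝ, ℝ) 𝓘(ℝ, E) ∞ γ ∧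
      (∀ t, γ t ∈ S) ∧ X = (mfderiv 𝓘(ℝ, ℝ) 𝓘(ℝ, E) γ 0 (1 : ℝ) : E)})

section Representations

variable {V : Type*} [NormedAddCommGroup V] [InnerProductSpace ℂ V] [FiniteDimensional ℂ V]

/-- The stabilizer `K_[v]` of the line `[v] = ℂ v` under a representation of `K`. -/
def Representation.lineStabilizer (π : Representation ℂ K V) (v : V) : Subgroup K where
  carrier := {u | (Submodule.span ℂ {v}).map (π u) = Submodule.span ℂ {v}}
  one_mem' := by
    simp only [Set.mem_ofPred_eq, map_one]
    exact Submodule.map_id _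
  mul_mem' := by
    intro a b ha hb
    simp only [Set.mem_ofPred_eq] at ha hb ⊢
    rw [map_mul, Module.End.mul_eq_comp, Submodule.map_comp, hb, ha]
  inv_mem' := by
    intro a ha
    simp only [Set.mem_ofPred_eq] at ha ⊢
    conv_lhs => rw [← ha]
    rw [← Submodule.map_comp, ← Module.End.mul_eq_comp, ← map_mul, inv_mul_cancel, map_one]
    exact Submodule.map_id _

/-- The representation as a map from `G` to the normed space of endomorphisms of `V`. -/
def Representation.toEnd (φ : Representation ℂ G V) (g : G) : V →L[ℂ] V :=
  LinearMap.toContinuousLinearMap (φ g)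

/-- The infinitesimal action `Φ : 𝔤 → End(V)`, the differential of `φ` at the identity. -/
def Representation.infinitesimal (F : Type*) [NormedAddCommGroup F] [NormedSpace ℂ F]
    {G : Type*} [TopologicalSpace G] [ChartedSpace F G] [Group G] (φ : Representation ℂ G V) :
    GroupLieAlgebra 𝓘(ℂ, F) G →L[ℂ] (V →L[ℂ] V) :=
  mfderiv 𝓘(ℂ, F) 𝓘(ℂ, V →L[ℂ] V) φ.toEnd 1

/-- The moment map `μ([v]) ∈ (i𝔨)^*`, `μ([v])(X) = ⟪v, Φ(X) v⟫ / ‖v‖²`. When the inner product is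
invariant under `K`, the operator `Φ(X)` is Hermitian for `X ∈ i𝔨`, so that `⟪v, Φ(X) v⟫` is
real and equal to its real part. -/
def momentMap (E : Type*) [NormedAddCommGroup E] [NormedSpace ℝ E]
    {K : Type*} [TopologicalSpace K] [ChartedSpace E K] [Group K]
    (F : Type*) [NormedAddCommGroup F] [NormedSpace ℂ F]
    {G : Type*} [TopologicalSpace G] [ChartedSpace F G] [Group G] (ι : K →* G)
    (φ : Representation ℂ G V) (v : V) : Module.Dual ℝ (iLieAlgebra E F ι) where
  toFun X := (inner ℂ v (φ.infinitesimal F X v)).re / ‖v‖ ^ 2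
  map_add' X Y := by
    rw [Submodule.coe_add, map_add, add_apply, inner_add_right, Complex.add_re,
      add_div]
  map_smul' c X := by
    have h : φ.infinitesimal F ((c • X : iLieAlgebra E F ι) : GroupLieAlgebra 𝓘(ℂ, F) G) =
        (c : ℂ) • φ.infinitesimal F X := by
      rw [← map_smul]
      rfl
    rw [h, smul_apply, inner_smul_right, Complex.re_ofReal_mul, mul_div_assoc]
    rfl

end Representations

end LieGroups

end

/-! Weyl's unitarian trick turns the problem into Laplace's method on `K`. Vectors of `V^{⊗k}` fixed
by `K` are fixed by `G` (`IsLieComplexification.apply_eq_self`), so `Π_k` averages over `K` on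
`v^{⊗k}`, and `norm_invariantProj_pow_sq` gives `‖Π_k v^{⊗k}‖² = ∫ ⟪v, u v⟫^k du` for the invariant
probability measure on `K`.

By Cauchy–Schwarz `|⟪v, u v⟫| ≤ 1`, with equality exactly on `K_[v]`, so the integral concentrates
there as `k → ∞`. Unitarity gives `Re ⟪v, u v⟫ = 1 - ρ²/2` with `ρ = ‖u v - v‖`. The hypothesis
`μ(v) = 0` controls the phase. It puts every `Φ(X) v` in `v^⊥`, by equivariance the same holds along
the whole orbit, and one more differentiation makes the tangent space isotropic for `Im ⟪·,·⟫`.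
Hence the imaginary part is `o(ρ²)` (`exists_abs_im_inner_le`), and the peak is a Gaussian in `ρ`
without oscillation at leading order.

The same estimate shows that near `v` the orbit meets the line `ℂ v` only in `v`, so by compactness
`K_[v]` acts on `v` through a finite group of scalars. If `m` is its order, the `m`-th power of the
coefficient equals `1` at every peak, and the contributions of the peaks add instead of cancelling.

It remains to see that `{u | ‖u v - v‖ ≤ r}` has measure asymptotic to `c r^d`, `c > 0`, where `d`
is the dimension of the orbit (`exists_tendsto_measure_dist_smul_le`). Products of one-parameter
subgroups parametrize the orbit near `v` by its tangent space (`exists_orbit_parametrization`),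
almost isometrically, so the Hausdorff measure of the orbit grows like this, and Fubini transfers
the growth to `K`. Then `tendsto_rpow_mul_integral_pow` yields the rate `k^{-d/2}` with a positive
constant. Finally `μ(v) = 0` identifies the Lie algebra of `K_[v]` with the annihilator of `v`, so
that `d = dim K - dim K_[v]` by rank–nullity. -/

noncomputable section

/-! ### Laplace's method in terms of the volume of small balls -/

section Laplace

open MeasureTheory Set

variable {Ω : Type*} [MeasurableSpace Ω] (P : Measure Ω) [IsProbabilityMeasure P]

/-- Layer-cake formula: write `e^{-y}` as the integral of `e^{-x}` over `x ≥ y` and exchange the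
integrals. -/
theorem integral_exp_neg_eq_integral_measure_le {y : Ω → ℝ} (hy : Measurable y)
    (hy0 : ∀ θ, 0 ≤ y θ) :
    ∫ θ, Real.exp (-y θ) ∂P = ∫ x in Ioi (0 : ℝ), Real.exp (-x) * P.real {θ | y θ ≤ x} := by
  have hexp : IntegrableOn (fun x : ℝ => Real.exp (-x)) (Ioi 0) := integrableOn_exp_neg_Ioi 0
  let g : Ω → ℝ → ℝ := fun θ x => {p : Ω × ℝ | y p.1 ≤ p.2}.indicator
    (fun p => Real.exp (-p.2)) (θ, x)
  have hms : MeasurableSet {p : Ω × ℝ | y p.1 ≤ p.2} :=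
    measurableSet_le (hy.comp measurable_fst) measurable_snd
  have hint : Integrable (Function.uncurry g) (P.prod (volume.restrict (Ioi (0 : ℝ)))) := by
    have h1 : Integrable (fun p : Ω × ℝ => Real.exp (-p.2))
        (P.prod (volume.restrict (Ioi (0 : ℝ)))) := hexp.comp_snd P
    exact h1.indicator hms
  have hswap := integral_integral_swap hint
  have hleft : ∀ θ, ∫ x in Ioi (0 : ℝ), g θ x = Real.exp (-y θ) := by
    intro θ
    have : (fun x => g θ x) = (Ici (y θ)).indicator (fun x => Real.exp (-x)) := by
      ext x
      simp [g, indicator]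
    rw [this, setIntegral_indicator measurableSet_Ici]
    rcases (hy0 θ).eq_or_lt with h0 | h0
    · rw [← h0, inter_eq_left.2 Ioi_subset_Ici_self, integral_exp_neg_Ioi]
    · have hsub : Ici (y θ) ⊆ Ioi 0 := fun x hx => h0.trans_le hx
      rw [inter_eq_right.2 hsub, integral_Ici_eq_integral_Ioi,
        integral_exp_neg_Ioi]
  have hright : ∀ x, ∫ θ, g θ x ∂P = Real.exp (-x) * P.real {θ | y θ ≤ x} := by
    intro x
    have : (fun θ => g θ x) = {θ | y θ ≤ x}.indicator (fun _ => Real.exp (-x)) := by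
      ext θ
      simp [g, indicator]
    rw [this, integral_indicator_const _ (measurableSet_le hy measurable_const), smul_eq_mul,
      mul_comm]
  simpa only [hleft, hright] using hswap

variable {P}

/-- Small `r` are covered by the limit, large `r` by `P ≤ 1`. The uniform bound supplies the
majorant for dominated convergence. -/
theorem exists_measure_le_le_mul_pow {ρ : Ω → ℝ} {d : ℕ} {c : ℝ}
    (hF : Tendsto (fun r => P.real {θ | ρ θ ≤ r} / r ^ d) (𝓝[>] 0) (𝓝 c)) :
    ∃ C : ℝ, ∀ r, 0 < r → P.real {θ | ρ θ ≤ r} / r ^ d ≤ C := by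
  have h1 : ∀ᶠ r in 𝓝[>] (0 : ℝ), P.real {θ | ρ θ ≤ r} / r ^ d < c + 1 :=
    hF.eventually_lt_const (lt_add_one c)
  obtain ⟨δ, hδ, h⟩ := mem_nhdsGT_iff_exists_Ioo_subset.1 h1
  refine ⟨max (c + 1) (1 / δ ^ d), fun r hr => ?_⟩
  have hδ : 0 < δ := hδ
  rcases lt_or_ge r δ with hr' | hr'
  · exact (h ⟨hr, hr'⟩ : _ < _).le.trans (le_max_left _ _)
  · refine le_trans ?_ (le_max_right _ _)
    exact div_le_div₀ zero_le_one measureReal_le_one (by positivity)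
      (pow_le_pow_left₀ hδ.le hr' d)

/-- A Gaussian Laplace integral is governed by the volume of small balls. -/
theorem tendsto_rpow_mul_integral_exp_neg_mul_sq {ρ : Ω → ℝ} (hρ : Measurable ρ)
    (hρ0 : ∀ θ, 0 ≤ ρ θ) {d : ℕ} {c : ℝ}
    (hF : Tendsto (fun r => P.real {θ | ρ θ ≤ r} / r ^ d) (𝓝[>] 0) (𝓝 c)) :
    Tendsto (fun t : ℝ => t ^ ((d : ℝ) / 2) * ∫ θ, Real.exp (-(t * ρ θ ^ 2)) ∂P) atTop
      (𝓝 (c * Real.Gamma ((d : ℝ) / 2 + 1))) := by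
  obtain ⟨C, hC⟩ := exists_measure_le_le_mul_pow hF
  -- The event `t ρ² ≤ x` is the ball of radius `√(x / t)`. The factor `t^{d/2}` turns its measure
  -- into the ball ratio times `x^{d/2}`, which completes `e^{-x}` to the integrand of `Γ(d/2 + 1)`.
  have key : ∀ t : ℝ, 0 < t → t ^ ((d : ℝ) / 2) * ∫ θ, Real.exp (-(t * ρ θ ^ 2)) ∂P =
      ∫ x in Ioi (0 : ℝ), (Real.exp (-x) * x ^ ((d : ℝ) / 2 + 1 - 1)) *
        (P.real {θ | ρ θ ≤ √(x / t)} / √(x / t) ^ d) := by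
    intro t ht
    rw [integral_exp_neg_eq_integral_measure_le P (by fun_prop)
      (fun θ => mul_nonneg ht.le (sq_nonneg _)), ← integral_const_mul]
    refine setIntegral_congr_fun measurableSet_Ioi fun x hx => ?_
    have hx : 0 < x := hx
    have hset : {θ | t * ρ θ ^ 2 ≤ x} = {θ | ρ θ ≤ √(x / t)} := by
      ext θ
      simp only [mem_ofPred_eq]
      rw [Real.le_sqrt (hρ0 θ), le_div_iff₀' ht]
      positivity
    have hpow : √(x / t) ^ d = x ^ ((d : ℝ) / 2) / t ^ ((d : ℝ) / 2) := by
      rw [Real.sqrt_eq_rpow, ← Real.rpow_natCast, ← Real.rpow_mul (by positivity),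
        Real.div_rpow hx.le ht.le]
      ring_nf
    simp only [hset, hpow, add_sub_cancel_right]
    have h1 : 0 < x ^ ((d : ℝ) / 2) := Real.rpow_pos_of_pos hx _
    have h2 : 0 < t ^ ((d : ℝ) / 2) := Real.rpow_pos_of_pos ht _
    field_simp
  have hΓ : IntegrableOn (fun x : ℝ => Real.exp (-x) * x ^ ((d : ℝ) / 2 + 1 - 1)) (Ioi 0) :=
    Real.GammaIntegral_convergent (by positivity)
  have hlim : Tendsto (fun t : ℝ => ∫ x in Ioi (0 : ℝ),
      (Real.exp (-x) * x ^ ((d : ℝ) / 2 + 1 - 1)) *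
        (P.real {θ | ρ θ ≤ √(x / t)} / √(x / t) ^ d)) atTop
      (𝓝 (∫ x in Ioi (0 : ℝ), (Real.exp (-x) * x ^ ((d : ℝ) / 2 + 1 - 1)) * c)) := by
    refine tendsto_integral_filter_of_dominated_convergence
      (fun x => (Real.exp (-x) * x ^ ((d : ℝ) / 2 + 1 - 1)) * C) ?_ ?_ (hΓ.mul_const C) ?_
    · filter_upwards with t
      have hmono : Monotone fun r => P.real {θ | ρ θ ≤ r} := fun r s hrs =>
        measureReal_mono fun θ (hθ : ρ θ ≤ r) => hθ.trans hrs
      have hm : Measurable fun x : ℝ => P.real {θ | ρ θ ≤ √(x / t)} :=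
        hmono.measurable.comp (by fun_prop)
      refine hΓ.1.mul (hm.div ?_).aestronglyMeasurable
      fun_prop
    · filter_upwards [eventually_gt_atTop 0] with t ht
      filter_upwards [ae_restrict_mem measurableSet_Ioi] with x hx
      have hx : 0 < x := hx
      rw [Real.norm_of_nonneg (by positivity)]
      exact mul_le_mul_of_nonneg_left (hC _ (by positivity)) (by positivity)
    · filter_upwards [ae_restrict_mem measurableSet_Ioi] with x hx
      have hx : 0 < x := hx
      refine Tendsto.const_mul _ (hF.comp ?_)
      refine tendsto_nhdsWithin_iff.2 ⟨?_, ?_⟩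
      · have : Tendsto (fun t : ℝ => x / t) atTop (𝓝 0) := tendsto_const_nhds.div_atTop tendsto_id
        simpa using this.sqrt
      · filter_upwards [eventually_gt_atTop 0] with t ht
        exact Real.sqrt_pos.2 (by positivity)
  have hval : ∫ x in Ioi (0 : ℝ), (Real.exp (-x) * x ^ ((d : ℝ) / 2 + 1 - 1)) * c =
      c * Real.Gamma ((d : ℝ) / 2 + 1) := by
    rw [integral_mul_const, Real.Gamma_eq_integral (by positivity), mul_comm]
  rw [← hval]
  refine hlim.congr' ?_
  filter_upwards [eventually_gt_atTop 0] with t ht using (key t ht).symm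

theorem norm_pow_sub_pow_le_of_norm_le {x y : ℂ} {M : ℝ} (hx : ‖x‖ ≤ M) (hy : ‖y‖ ≤ M) (n : ℕ) :
    ‖x ^ (n + 1) - y ^ (n + 1)‖ ≤ (n + 1) * M ^ n * ‖x - y‖ := by
  rw [sub_eq_add_neg, ← sub_eq_add_neg, ← Commute.geom_sum₂_mul (Commute.all x y), norm_mul]
  gcongr
  refine (norm_sum_le _ _).trans ?_
  have : ∀ i ∈ Finset.range (n + 1), ‖x ^ i * y ^ (n + 1 - 1 - i)‖ ≤ M ^ n := by
    intro i hi
    have hi : i ≤ n := Nat.lt_succ_iff.1 (Finset.mem_range.1 hi)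
    rw [norm_mul, norm_pow, norm_pow, Nat.add_sub_cancel]
    calc ‖x‖ ^ i * ‖y‖ ^ (n - i) ≤ M ^ i * M ^ (n - i) := by
          gcongr
          exact pow_nonneg ((norm_nonneg _).trans hx) _
      _ = M ^ n := by rw [← pow_add, Nat.add_sub_cancel' hi]
  exact (Finset.sum_le_card_nsmul _ _ _ this).trans (by simp)

/-- Both `z` and `e^{-as}` have norm at most `e^{-as/2}` and they differ by at most `2 ε s`;
telescoping their powers costs a factor `n + 2`. Half of the remaining decay absorbs `(n + 2) s`,
the other half survives as a Gaussian of rate `a / 8` when `s = ρ²`. The exponent is at least `2` so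
that `(n + 1) / 2 ≥ (n + 2) / 4`. -/
theorem norm_pow_sub_exp_le {z : ℂ} {a ε s : ℝ} (ha : 0 < a) (hε : 0 < ε) (hεa : ε ≤ a / 2)
    (hs : 0 ≤ s) (hs1 : a * s ≤ 1) (hs2 : a ^ 2 * s ≤ ε)
    (hz : ‖z - (1 - a * s : ℝ)‖ ≤ ε * s) (n : ℕ) :
    ‖z ^ (n + 2) - (Real.exp (-((n + 2 : ℕ) * (a * s))) : ℝ)‖ ≤
      16 * ε / a * Real.exp (-((n + 2 : ℕ) * (a / 8) * s)) := by
  have hM : ‖z‖ ≤ Real.exp (-(a * s / 2)) := by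
    calc ‖z‖ ≤ ‖z - (1 - a * s : ℝ)‖ + ‖((1 - a * s : ℝ) : ℂ)‖ := by
          simpa using norm_add_le (z - (1 - a * s : ℝ)) ((1 - a * s : ℝ) : ℂ)
      _ ≤ ε * s + (1 - a * s) := by
          gcongr
          rw [Complex.norm_real, Real.norm_of_nonneg (by linarith)]
      _ ≤ -(a * s / 2) + 1 := by nlinarith
      _ ≤ _ := Real.add_one_le_exp _
  have hE : ‖((Real.exp (-(a * s)) : ℝ) : ℂ)‖ ≤ Real.exp (-(a * s / 2)) := by
    rw [Complex.norm_real, Real.norm_of_nonneg (Real.exp_pos _).le, Real.exp_le_exp]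
    have := mul_nonneg ha.le hs
    linarith
  have hdiff : ‖z - (Real.exp (-(a * s)) : ℝ)‖ ≤ 2 * ε * s := by
    have h1 : ‖((1 - a * s : ℝ) : ℂ) - (Real.exp (-(a * s)) : ℝ)‖ ≤ ε * s := by
      rw [← Complex.ofReal_sub, Complex.norm_real, Real.norm_eq_abs, abs_sub_comm]
      have := Real.abs_exp_sub_one_sub_id_le (x := -(a * s)) (by
        rw [abs_neg, abs_of_nonneg (by positivity)]; exact hs1)
      calc |Real.exp (-(a * s)) - (1 - a * s)| = |Real.exp (-(a * s)) - 1 - -(a * s)| := by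
            congr 1; ring
        _ ≤ (-(a * s)) ^ 2 := this
        _ = (a ^ 2 * s) * s := by ring
        _ ≤ ε * s := by gcongr
    calc ‖z - (Real.exp (-(a * s)) : ℝ)‖
        ≤ ‖z - (1 - a * s : ℝ)‖ + ‖((1 - a * s : ℝ) : ℂ) - (Real.exp (-(a * s)) : ℝ)‖ := by
          exact norm_sub_le_norm_sub_add_norm_sub _ _ _
      _ ≤ 2 * ε * s := by linarith
  have hpow : ((Real.exp (-((n + 2 : ℕ) * (a * s))) : ℝ) : ℂ) =
      ((Real.exp (-(a * s)) : ℝ) : ℂ) ^ (n + 2) := by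
    rw [← Complex.ofReal_pow, ← Real.exp_nat_mul]
    congr 2
    ring
  rw [hpow]
  refine (norm_pow_sub_pow_le_of_norm_le hM hE (n + 1)).trans ?_
  rw [← Real.exp_nat_mul]
  set x : ℝ := (n + 2 : ℕ) * (a / 8) * s with hx
  have hx0 : 0 ≤ x := by positivity
  have h1 : Real.exp ((n + 1 : ℕ) * -(a * s / 2)) ≤ Real.exp (-x) * Real.exp (-x) := by
    rw [← Real.exp_add, Real.exp_le_exp, hx]
    push_cast
    have : 0 ≤ a * s := by positivity
    have hn : (0 : ℝ) ≤ n := by positivity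
    nlinarith [mul_nonneg hn this]
  have h2 : x * Real.exp (-x) ≤ 1 := by
    rw [Real.exp_neg, ← div_eq_mul_inv, div_le_one (Real.exp_pos _)]
    linarith [Real.add_one_le_exp x]
  calc ((n + 1 : ℕ) + 1 : ℝ) * Real.exp ((n + 1 : ℕ) * -(a * s / 2)) *
        ‖z - (Real.exp (-(a * s)) : ℝ)‖
      ≤ ((n + 1 : ℕ) + 1 : ℝ) * (Real.exp (-x) * Real.exp (-x)) * (2 * ε * s) := by gcongr
    _ = 16 * ε / a * ((x * Real.exp (-x)) * Real.exp (-x)) := by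
        rw [hx]; push_cast; field_simp; ring
    _ ≤ 16 * ε / a * (1 * Real.exp (-x)) := by gcongr
    _ = _ := by rw [one_mul]

theorem tendsto_rpow_mul_pow_atTop_nhds_zero (s : ℝ) {q : ℝ} (hq0 : 0 ≤ q) (hq : q < 1) :
    Tendsto (fun k : ℕ => (k : ℝ) ^ s * q ^ k) atTop (𝓝 0) := by
  obtain ⟨n, hn⟩ := exists_nat_ge s
  refine squeeze_zero' (g := fun k : ℕ => (k : ℝ) ^ n * q ^ k) ?_ ?_
    (tendsto_pow_const_mul_const_pow_of_lt_one n hq0 hq)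
  · filter_upwards with k
    positivity
  · filter_upwards [eventually_ge_atTop 1] with k hk
    gcongr
    rw [← Real.rpow_natCast]
    exact Real.rpow_le_rpow_of_exponent_le (by exact_mod_cast hk) hn

/-- Laplace's method for the powers of a function `h` with a single peak `h = 1 - a ρ² + o(ρ²)`. -/
theorem tendsto_rpow_mul_integral_pow {ρ : Ω → ℝ} (hρ : Measurable ρ)
    (hρ0 : ∀ θ, 0 ≤ ρ θ) {d : ℕ} {c : ℝ}
    (hF : Tendsto (fun r => P.real {θ | ρ θ ≤ r} / r ^ d) (𝓝[>] 0) (𝓝 c))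
    {h : Ω → ℂ} (hh : Measurable h) (hh1 : ∀ θ, ‖h θ‖ ≤ 1) {a : ℝ} (ha : 0 < a)
    (hnear : ∀ ε > 0, ∃ δ > 0, ∀ θ, ρ θ < δ → ‖h θ - (1 - a * ρ θ ^ 2 : ℝ)‖ ≤ ε * ρ θ ^ 2)
    (hfar : ∀ δ > 0, ∃ q < 1, ∀ θ, δ ≤ ρ θ → ‖h θ‖ ≤ q) :
    Tendsto (fun k : ℕ => ((k : ℝ) ^ ((d : ℝ) / 2) : ℝ) * ∫ θ, h θ ^ k ∂P) atTop
      (𝓝 ((a ^ (-((d : ℝ) / 2)) * (c * Real.Gamma ((d : ℝ) / 2 + 1)) : ℝ) : ℂ)) := by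
  set D : ℝ := (d : ℝ) / 2 with hD
  have hscale : ∀ b : ℝ, 0 < b → Tendsto (fun k : ℕ => (k : ℝ) ^ D *
      ∫ θ, Real.exp (-(k * b * ρ θ ^ 2)) ∂P) atTop
      (𝓝 (b ^ (-D) * (c * Real.Gamma (D + 1)))) := by
    intro b hb
    have h1 : Tendsto (fun k : ℕ => (k : ℝ) * b) atTop atTop :=
      tendsto_natCast_atTop_atTop.atTop_mul_const hb
    refine (((tendsto_rpow_mul_integral_exp_neg_mul_sq hρ hρ0 hF).comp h1).const_mul
      (b ^ (-D))).congr fun k => ?_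
    simp only [Function.comp]
    rw [Real.mul_rpow (by positivity) hb.le, ← mul_assoc, Real.rpow_neg hb.le]
    have : 0 < b ^ D := Real.rpow_pos_of_pos hb _
    rw [← hD]
    field_simp
  have hexpint : ∀ b : ℝ, 0 ≤ b → Integrable (fun θ => Real.exp (-(b * ρ θ ^ 2))) P := by
    intro b hb
    refine Integrable.of_bound (C := 1) (by fun_prop) (ae_of_all _ fun θ => ?_)
    rw [Real.norm_of_nonneg (Real.exp_pos _).le, Real.exp_le_one_iff]
    have := mul_nonneg hb (sq_nonneg (ρ θ))
    linarith
  have hhint : ∀ k : ℕ, Integrable (fun θ => h θ ^ k) P := by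
    intro k
    refine Integrable.of_bound (C := 1) (by fun_prop) (ae_of_all _ fun θ => ?_)
    rw [norm_pow]
    exact pow_le_one₀ (norm_nonneg _) (hh1 θ)
  have hmain := (hscale a ha)
  have hmain' : Tendsto (fun k : ℕ => (((k : ℝ) ^ D *
      ∫ θ, Real.exp (-(k * a * ρ θ ^ 2)) ∂P : ℝ) : ℂ)) atTop
      (𝓝 ((a ^ (-D) * (c * Real.Gamma (D + 1)) : ℝ) : ℂ)) :=
    (Complex.continuous_ofReal.tendsto _).comp hmain
  suffices hsub : Tendsto (fun k : ℕ => (((k : ℝ) ^ D : ℝ) : ℂ) * ∫ θ, h θ ^ k ∂P -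
      (((k : ℝ) ^ D * ∫ θ, Real.exp (-(k * a * ρ θ ^ 2)) ∂P : ℝ) : ℂ)) atTop (𝓝 0) by
    simpa using hsub.add hmain'
  rw [Metric.tendsto_nhds]
  intro η hη
  set L' : ℝ := (a / 8) ^ (-D) * (c * Real.Gamma (D + 1))
  -- `L'` is the limit of the scaled Gaussian integral of rate `a / 8`, so the error near the peak
  -- will tend to `16 ε / a * L'`.
  obtain ⟨ε, hε, hεa, hεη⟩ : ∃ ε : ℝ, 0 < ε ∧ ε ≤ a / 2 ∧ 16 * ε / a * (|L'| + 1) < η := by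
    refine ⟨min (a / 2) (η * a / (32 * (|L'| + 1))), by positivity, min_le_left _ _, ?_⟩
    have h1 : min (a / 2) (η * a / (32 * (|L'| + 1))) ≤ η * a / (32 * (|L'| + 1)) :=
      min_le_right _ _
    calc _ ≤ 16 * (η * a / (32 * (|L'| + 1))) / a * (|L'| + 1) := by gcongr
      _ = η / 2 := by field_simp; norm_num
      _ < η := by linarith
  obtain ⟨δ₀, hδ₀, hδ⟩ := hnear ε hε
  obtain ⟨δ, hδpos, hδle, hδ1, hδ2⟩ : ∃ δ > 0, δ ≤ δ₀ ∧ a * δ ^ 2 ≤ 1 ∧ a ^ 2 * δ ^ 2 ≤ ε := by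
    have h1 : Tendsto (fun δ : ℝ => a * δ ^ 2) (𝓝[>] 0) (𝓝 0) := by
      have : Continuous fun δ : ℝ => a * δ ^ 2 := by fun_prop
      simpa using (this.tendsto 0).mono_left nhdsWithin_le_nhds
    have h2 : Tendsto (fun δ : ℝ => a ^ 2 * δ ^ 2) (𝓝[>] 0) (𝓝 0) := by
      have : Continuous fun δ : ℝ => a ^ 2 * δ ^ 2 := by fun_prop
      simpa using (this.tendsto 0).mono_left nhdsWithin_le_nhds
    have h3 : ∀ᶠ δ : ℝ in 𝓝[>] 0, δ < δ₀ :=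
      (eventually_lt_nhds hδ₀).filter_mono nhdsWithin_le_nhds
    obtain ⟨δ, ⟨⟨h4, h5⟩, h6⟩, h7⟩ := (((h1.eventually_lt_const one_pos).and
      (h2.eventually_lt_const hε)).and h3).and self_mem_nhdsWithin |>.exists
    exact ⟨δ, h7, h6.le, h4.le, h5.le⟩
  obtain ⟨q₀, hq₀, hfar'⟩ := hfar δ hδpos
  -- Off the `δ`-ball, `q^k` bounds both the power of `h` and the Gaussian it is compared with.
  set q : ℝ := max (max q₀ 0) (Real.exp (-(a * δ ^ 2))) with hq
  have hq0 : 0 ≤ q := (le_max_right _ _).trans (le_max_left _ _)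
  have hq1 : q < 1 := by
    refine max_lt (max_lt hq₀ one_pos) ?_
    rw [Real.exp_lt_one_iff]
    have : 0 < a * δ ^ 2 := by positivity
    linarith
  have hpt : ∀ n : ℕ, ∀ θ, ‖h θ ^ (n + 2) - (Real.exp (-((n + 2 : ℕ) * a * ρ θ ^ 2)) : ℝ)‖ ≤
      16 * ε / a * Real.exp (-((n + 2 : ℕ) * (a / 8) * ρ θ ^ 2)) + 2 * q ^ (n + 2) := by
    intro n θ
    rcases lt_or_ge (ρ θ) δ with hlt | hge
    · have hs : ρ θ ^ 2 ≤ δ ^ 2 := pow_le_pow_left₀ (hρ0 θ) hlt.le 2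
      have := norm_pow_sub_exp_le ha hε hεa (sq_nonneg (ρ θ))
        ((mul_le_mul_of_nonneg_left hs ha.le).trans hδ1)
        ((mul_le_mul_of_nonneg_left hs (sq_nonneg a)).trans hδ2) (hδ θ (hlt.trans_le hδle)) n
      rw [← mul_assoc] at this
      exact this.trans (le_add_of_nonneg_right (by positivity))
    · refine le_trans (norm_sub_le _ _) (le_trans ?_ (le_add_of_nonneg_left (by positivity)))
      have h1 : ‖h θ ^ (n + 2)‖ ≤ q ^ (n + 2) := by
        rw [norm_pow]
        gcongr
        exact (hfar' θ hge).trans ((le_max_left _ _).trans (le_max_left _ _))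
      have h2 : ‖((Real.exp (-((n + 2 : ℕ) * a * ρ θ ^ 2)) : ℝ) : ℂ)‖ ≤ q ^ (n + 2) := by
        rw [Complex.norm_real, Real.norm_of_nonneg (Real.exp_pos _).le]
        calc Real.exp (-((n + 2 : ℕ) * a * ρ θ ^ 2)) ≤ Real.exp ((n + 2 : ℕ) * (-(a * δ ^ 2))) := by
              rw [Real.exp_le_exp, mul_neg, neg_le_neg_iff, mul_assoc]
              gcongr
          _ = Real.exp (-(a * δ ^ 2)) ^ (n + 2) := Real.exp_nat_mul _ _
          _ ≤ q ^ (n + 2) := by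
              gcongr
              exact le_max_right _ _
      linarith
  have hbound : ∀ k : ℕ, 2 ≤ k → ‖(((k : ℝ) ^ D : ℝ) : ℂ) * ∫ θ, h θ ^ k ∂P -
      (((k : ℝ) ^ D * ∫ θ, Real.exp (-(k * a * ρ θ ^ 2)) ∂P : ℝ) : ℂ)‖ ≤
      16 * ε / a * ((k : ℝ) ^ D * ∫ θ, Real.exp (-(k * (a / 8) * ρ θ ^ 2)) ∂P) +
        2 * ((k : ℝ) ^ D * q ^ k) := by
    intro k hk
    obtain ⟨n, rfl⟩ := Nat.exists_eq_add_of_le' hk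
    have hE : Integrable (fun θ => ((Real.exp (-((n + 2 : ℕ) * a * ρ θ ^ 2)) : ℝ) : ℂ)) P :=
      (hexpint _ (by positivity)).ofReal
    rw [Complex.ofReal_mul, ← mul_sub, norm_mul, Complex.norm_real,
      Real.norm_of_nonneg (by positivity), ← integral_complex_ofReal, ← integral_sub (hhint _) hE]
    calc _ ≤ ((n + 2 : ℕ) : ℝ) ^ D * ∫ θ, (16 * ε / a *
          Real.exp (-((n + 2 : ℕ) * (a / 8) * ρ θ ^ 2)) + 2 * q ^ (n + 2)) ∂P := by
          gcongr
          refine norm_integral_le_of_norm_le ?_ (ae_of_all _ (hpt n))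
          exact ((hexpint _ (by positivity)).const_mul _).add (integrable_const _)
      _ = _ := by
          rw [integral_add ((hexpint _ (by positivity)).const_mul _) (integrable_const _),
            integral_const_mul, integral_const, probReal_univ, one_smul]
          ring
  have hlim : Tendsto (fun k : ℕ => 16 * ε / a * ((k : ℝ) ^ D *
      ∫ θ, Real.exp (-(k * (a / 8) * ρ θ ^ 2)) ∂P) + 2 * ((k : ℝ) ^ D * q ^ k)) atTop
      (𝓝 (16 * ε / a * L' + 2 * 0)) :=
    ((hscale (a / 8) (by positivity)).const_mul _).add
      ((tendsto_rpow_mul_pow_atTop_nhds_zero D hq0 hq1).const_mul _)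
  have hlt : 16 * ε / a * L' + 2 * 0 < η := by
    refine lt_of_le_of_lt ?_ hεη
    rw [mul_zero, add_zero]
    gcongr
    linarith [le_abs_self L']
  filter_upwards [hlim.eventually_lt_const hlt, eventually_ge_atTop 2] with k hk hk2
  rw [dist_zero_right]
  exact (hbound k hk2).trans_lt hk

end Laplace

/-! ### Hausdorff measure of an orbit and the invariant volume of small balls -/

section HausdorffOrbit

open MeasureTheory Set Metric
open scoped ENNReal NNReal

variable {X : Type*} [MetricSpace X] [MeasurableSpace X] [BorelSpace X]

section Chart

variable {T : Type*} [NormedAddCommGroup T] [NormedSpace ℝ T] [FiniteDimensional ℝ T]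
  [MeasurableSpace T] [BorelSpace T]

theorem hausdorffMeasure_closedBall (x : T) {s : ℝ} (hs : 0 ≤ s) :
    μH[Module.finrank ℝ T] (closedBall x s) =
      ENNReal.ofReal (s ^ Module.finrank ℝ T) * μH[Module.finrank ℝ T] (ball (0 : T) 1) :=
  Measure.addHaar_closedBall _ x hs

/-- A map which is almost isometric near `0` and covers a set `O` near `α 0` computes the Hausdorff
measure of small balls of `O` up to a factor close to `1`. -/
theorem hausdorffMeasure_inter_closedBall_bounds {O : Set X} {α : T → X} (hαO : ∀ x, α x ∈ O)
    {η δ : ℝ} (hη0 : 0 < η) (hη1 : η < 1)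
    (hlow : ∀ x ∈ closedBall (0 : T) δ, ∀ y ∈ closedBall (0 : T) δ,
      (1 - η) * dist x y ≤ dist (α x) (α y))
    (hupp : ∀ x ∈ closedBall (0 : T) δ, ∀ y ∈ closedBall (0 : T) δ,
      dist (α x) (α y) ≤ (1 + η) * dist x y)
    {r₀ : ℝ} (hcov : O ∩ closedBall (α 0) r₀ ⊆ α '' closedBall 0 δ)
    {r : ℝ} (hr : 0 < r) (hr₀ : r ≤ r₀) (hrδ : r / (1 - η) ≤ δ) :
    ENNReal.ofReal (((1 - η) / (1 + η)) ^ Module.finrank ℝ T * r ^ Module.finrank ℝ T) *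
        μH[Module.finrank ℝ T] (ball (0 : T) 1) ≤
      μH[Module.finrank ℝ T] (O ∩ closedBall (α 0) r) ∧
    μH[Module.finrank ℝ T] (O ∩ closedBall (α 0) r) ≤
      ENNReal.ofReal (((1 + η) / (1 - η)) ^ Module.finrank ℝ T * r ^ Module.finrank ℝ T) *
        μH[Module.finrank ℝ T] (ball (0 : T) 1) := by
  set d := Module.finrank ℝ T
  have h1η : 0 < 1 - η := by linarith
  have hδ : 0 ≤ δ := le_trans (by positivity) hrδ
  have h0 : (0 : T) ∈ closedBall (0 : T) δ := mem_closedBall_self hδ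
  constructor
  -- Lower bound: `α` maps this ball into the ball of radius `r`, and its inverse on the image is
  -- Lipschitz with constant `(1 - η)⁻¹`.
  · set B : Set T := closedBall 0 (r / (1 + η)) with hB
    have hBδ : B ⊆ closedBall 0 δ := closedBall_subset_closedBall (le_trans
      (div_le_div_of_nonneg_left hr.le h1η (by linarith)) hrδ)
    have hsub : α '' B ⊆ O ∩ closedBall (α 0) r := by
      rintro _ ⟨x, hx, rfl⟩
      refine ⟨hαO x, mem_closedBall.2 ((hupp x (hBδ hx) 0 h0).trans ?_)⟩
      have := mem_closedBall.1 hx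
      rwa [le_div_iff₀' (by positivity)] at this
    have hinj : InjOn α B := by
      intro x hx y hy hxy
      have := hlow x (hBδ hx) y (hBδ hy)
      rw [hxy, dist_self] at this
      exact dist_le_zero.1 (nonpos_of_mul_nonpos_right this h1η)
    let κ : ℝ≥0 := ⟨(1 - η)⁻¹, (inv_pos.2 h1η).le⟩
    have hlip : LipschitzOnWith κ (Function.invFunOn α B) (α '' B) := by
      refine LipschitzOnWith.of_dist_le_mul ?_
      rintro _ ⟨x, hx, rfl⟩ _ ⟨y, hy, rfl⟩
      rw [hinj.leftInvOn_invFunOn hx, hinj.leftInvOn_invFunOn hy]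
      change _ ≤ (1 - η)⁻¹ * _
      rw [inv_mul_eq_div, le_div_iff₀' h1η]
      exact hlow x (hBδ hx) y (hBδ hy)
    have himg : Function.invFunOn α B '' (α '' B) = B := by
      rw [hinj.invFunOn_image Subset.rfl]
    have h1 := hlip.hausdorffMeasure_image_le (d := (d : ℝ)) (by positivity)
    rw [himg, hausdorffMeasure_closedBall 0 (by positivity)] at h1
    have hκ : ((κ : ℝ≥0∞) ^ (d : ℝ)) = ENNReal.ofReal ((1 - η)⁻¹ ^ d) := by
      rw [ENNReal.rpow_natCast, ENNReal.ofReal_pow (by positivity)]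
      congr 1
      exact (ENNReal.ofReal_eq_coe_nnreal _).symm
    rw [hκ] at h1
    calc _ = ENNReal.ofReal ((1 - η) ^ d) * (ENNReal.ofReal ((r / (1 + η)) ^ d) *
          μH[(d : ℝ)] (ball (0 : T) 1)) := by
          rw [← mul_assoc, ← ENNReal.ofReal_mul (by positivity), ← mul_pow, ← mul_pow]
          congr 3
          ring
      _ ≤ ENNReal.ofReal ((1 - η) ^ d) * (ENNReal.ofReal ((1 - η)⁻¹ ^ d) *
          μH[(d : ℝ)] (α '' B)) := by gcongr
      _ = μH[(d : ℝ)] (α '' B) := by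
          rw [← mul_assoc, ← ENNReal.ofReal_mul (by positivity), ← mul_pow,
            mul_inv_cancel₀ h1η.ne', one_pow, ENNReal.ofReal_one, one_mul]
      _ ≤ _ := measure_mono hsub
  -- Upper bound: the image of this ball covers the part of `O` in the ball of radius `r`.
  · set B : Set T := closedBall 0 (r / (1 - η)) with hB
    have hBδ : B ⊆ closedBall 0 δ := closedBall_subset_closedBall hrδ
    have hsub : O ∩ closedBall (α 0) r ⊆ α '' B := by
      intro w hw
      obtain ⟨x, hx, rfl⟩ := hcov ⟨hw.1, closedBall_subset_closedBall hr₀ hw.2⟩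
      refine ⟨x, ?_, rfl⟩
      rw [hB, mem_closedBall, le_div_iff₀' h1η]
      exact (hlow x hx 0 h0).trans (mem_closedBall.1 hw.2)
    let κ : ℝ≥0 := ⟨1 + η, by linarith⟩
    have hlip : LipschitzOnWith κ α B := LipschitzOnWith.of_dist_le_mul fun x hx y hy =>
      hupp x (hBδ hx) y (hBδ hy)
    have h1 := hlip.hausdorffMeasure_image_le (d := (d : ℝ)) (by positivity)
    rw [hausdorffMeasure_closedBall 0 (by positivity)] at h1
    have hκ : ((κ : ℝ≥0∞) ^ (d : ℝ)) = ENNReal.ofReal ((1 + η) ^ d) := by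
      rw [ENNReal.rpow_natCast, ENNReal.ofReal_pow (by positivity)]
      congr 1
      exact (ENNReal.ofReal_eq_coe_nnreal _).symm
    rw [hκ] at h1
    refine (measure_mono hsub).trans (h1.trans_eq ?_)
    rw [← mul_assoc, ← ENNReal.ofReal_mul (by positivity), ← mul_pow, ← mul_pow]
    congr 3
    ring

/-- The distortion `η` can be taken arbitrarily small on small balls, and both bounds of
`hausdorffMeasure_inter_closedBall_bounds` tend to the measure of the unit ball as `η → 0`. -/
theorem tendsto_hausdorffMeasure_inter_closedBall {O : Set X} {α : T → X} (hαO : ∀ x, α x ∈ O)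
    (hα : ∀ η > 0, ∃ δ > 0, ∀ x ∈ closedBall (0 : T) δ, ∀ y ∈ closedBall (0 : T) δ,
      |dist (α x) (α y) - dist x y| ≤ η * dist x y)
    (hcov : ∀ δ > 0, ∃ r₀ > 0, O ∩ closedBall (α 0) r₀ ⊆ α '' closedBall 0 δ) :
    Tendsto (fun r : ℝ => (μH[Module.finrank ℝ T] (O ∩ closedBall (α 0) r)).toReal /
      r ^ Module.finrank ℝ T) (𝓝[>] 0)
      (𝓝 (μH[Module.finrank ℝ T] (ball (0 : T) 1)).toReal) := by
  set d := Module.finrank ℝ T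
  set V := (μH[(d : ℝ)] (ball (0 : T) 1)) with hV
  have hVtop : V ≠ ⊤ := measure_ball_lt_top.ne
  have hb : ∀ η : ℝ, 0 < η → η < 1 → ∀ᶠ r in 𝓝[>] (0 : ℝ),
      ((1 - η) / (1 + η)) ^ d * V.toReal ≤
        (μH[(d : ℝ)] (O ∩ closedBall (α 0) r)).toReal / r ^ d ∧
      (μH[(d : ℝ)] (O ∩ closedBall (α 0) r)).toReal / r ^ d ≤
        ((1 + η) / (1 - η)) ^ d * V.toReal := by
    intro η hη0 hη1
    have h1η : 0 < 1 - η := by linarith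
    obtain ⟨δ, hδ, h⟩ := hα η hη0
    obtain ⟨r₀, hr₀, hcov⟩ := hcov δ hδ
    have hev : ∀ᶠ r : ℝ in 𝓝[>] 0, r < r₀ ∧ r < δ * (1 - η) :=
      ((eventually_lt_nhds hr₀).and (eventually_lt_nhds (by positivity))).filter_mono
        nhdsWithin_le_nhds
    filter_upwards [hev, self_mem_nhdsWithin] with r hr hr0
    have hr0 : 0 < r := hr0
    obtain ⟨h1, h2⟩ := hausdorffMeasure_inter_closedBall_bounds hαO hη0 hη1
      (fun x hx y hy => by have := (abs_le.1 (h x hx y hy)).1; linarith)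
      (fun x hx y hy => by have := (abs_le.1 (h x hx y hy)).2; linarith)
      hcov hr0 hr.1.le ((div_le_iff₀ h1η).2 hr.2.le)
    have hfin := ENNReal.mul_ne_top (ENNReal.ofReal_ne_top (r := ((1 + η) / (1 - η)) ^ d * r ^ d))
      hVtop
    have h1' := ENNReal.toReal_mono (ne_top_of_le_ne_top hfin h2) h1
    have h2' := ENNReal.toReal_mono hfin h2
    rw [ENNReal.toReal_mul, ENNReal.toReal_ofReal (by positivity)] at h1' h2'
    rw [le_div_iff₀ (by positivity), div_le_iff₀ (by positivity)]
    constructor <;> linarith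
  have hlow : Tendsto (fun η : ℝ => ((1 - η) / (1 + η)) ^ d * V.toReal) (𝓝[>] 0)
      (𝓝 V.toReal) := by
    have : ContinuousAt (fun η : ℝ => ((1 - η) / (1 + η)) ^ d * V.toReal) 0 := by
      refine ContinuousAt.mul (ContinuousAt.pow (ContinuousAt.div ?_ ?_ (by norm_num)) _) ?_ <;>
        fun_prop
    simpa using this.tendsto.mono_left nhdsWithin_le_nhds
  have hupp : Tendsto (fun η : ℝ => ((1 + η) / (1 - η)) ^ d * V.toReal) (𝓝[>] 0)
      (𝓝 V.toReal) := by
    have : ContinuousAt (fun η : ℝ => ((1 + η) / (1 - η)) ^ d * V.toReal) 0 := by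
      refine ContinuousAt.mul (ContinuousAt.pow (ContinuousAt.div ?_ ?_ (by norm_num)) _) ?_ <;>
        fun_prop
    simpa using this.tendsto.mono_left nhdsWithin_le_nhds
  have hη : ∀ᶠ η : ℝ in 𝓝[>] 0, 0 < η ∧ η < 1 :=
    (Ioo_mem_nhdsGT one_pos)
  refine tendsto_order.2 ⟨fun l hl => ?_, fun l hl => ?_⟩
  · obtain ⟨η, h1, h2, h3⟩ := ((hlow.eventually_const_lt hl).and hη).exists
    filter_upwards [hb η h2 h3] with r hr using h1.trans_le hr.1
  · obtain ⟨η, h1, h2, h3⟩ := ((hupp.eventually_lt_const hl).and hη).exists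
    filter_upwards [hb η h2 h3] with r hr using hr.2.trans_lt h1

end Chart

variable {K : Type*} [Group K] [MulAction K X] [IsIsometricSMul K X]

theorem hausdorffMeasure_orbit_inter_closedBall_smul (d : ℝ) (v : X) (u : K) (r : ℝ) :
    μH[d] (MulAction.orbit K v ∩ closedBall (u • v) r) =
      μH[d] (MulAction.orbit K v ∩ closedBall v r) := by
  rw [← Metric.smul_closedBall, ← MulAction.smul_orbit u v, ← Set.smul_set_inter,
    hausdorffMeasure_smul _ (Or.inr (MulAction.surjective u)), MulAction.smul_orbit]

variable [TopologicalSpace K] [CompactSpace K]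

/-- The compact orbit is covered by finitely many translates of one ball, and the isometric action
gives all their traces on the orbit the same measure. -/
theorem hausdorffMeasure_orbit_lt_top {d : ℝ} {v : X} (hcont : Continuous fun u : K => u • v)
    {r : ℝ} (hr : 0 < r) (hfin : μH[d] (MulAction.orbit K v ∩ closedBall v r) ≠ ⊤) :
    μH[d] (MulAction.orbit K v) ≠ ⊤ := by
  have hcpt : IsCompact (MulAction.orbit K v) := isCompact_range hcont
  obtain ⟨t, -, ht⟩ := hcpt.elim_finite_subcover_image (b := univ)
    (c := fun u : K => ball (u • v) r) (fun _ _ => isOpen_ball) (by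
      rintro _ ⟨u, rfl⟩
      exact mem_biUnion (mem_univ u) (mem_ball_self hr))
  obtain ⟨htfin, ht⟩ := ht
  have hsub : MulAction.orbit K v ⊆ ⋃ u ∈ t, MulAction.orbit K v ∩ closedBall (u • v) r := by
    intro w hw
    obtain ⟨u, hu, hwu⟩ := mem_iUnion₂.1 (ht hw)
    exact mem_iUnion₂.2 ⟨u, hu, hw, ball_subset_closedBall hwu⟩
  refine ((measure_mono hsub).trans_lt (measure_biUnion_lt_top htfin fun u _ => ?_)).ne
  rw [hausdorffMeasure_orbit_inter_closedBall_smul]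
  exact lt_top_iff_ne_top.2 hfin

variable [IsTopologicalGroup K] [MeasurableSpace K] [BorelSpace K] [SecondCountableTopology X]

/-- Double counting of the pairs `(w, u)` with `dist (u • v) w ≤ r`, for `w` in the orbit and `u` in
`K`. By invariance each of the two inner integrals is constant. This replaces an invariant measure
on the quotient of `K` by the stabilizer. -/
theorem measure_dist_smul_le_mul_hausdorffMeasure_orbit (P : Measure K) [IsProbabilityMeasure P]
    [P.IsMulLeftInvariant] {d : ℝ} {v : X} (hcont : Continuous fun u : K => u • v)
    (hfin : μH[d] (MulAction.orbit K v) ≠ ⊤) (r : ℝ) :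
    P {u | dist (u • v) v ≤ r} * μH[d] (MulAction.orbit K v) =
      μH[d] (MulAction.orbit K v ∩ closedBall v r) := by
  set O := MulAction.orbit K v with hO
  have hOm : MeasurableSet O := (isCompact_range hcont).measurableSet
  have : IsFiniteMeasure ((μH[d] : Measure X).restrict O) :=
    ⟨by rw [Measure.restrict_apply_univ]; exact lt_top_iff_ne_top.2 hfin⟩
  have hm : MeasurableSet {p : X × K | dist (p.2 • v) p.1 ≤ r} := by
    refine measurableSet_le (Measurable.dist (hcont.measurable.comp measurable_snd)
      measurable_fst) measurable_const
  have hswap := lintegral_lintegral_swap (μ := (μH[d] : Measure X).restrict O) (ν := P)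
    (f := fun w u => {p : X × K | dist (p.2 • v) p.1 ≤ r}.indicator 1 (w, u))
    ((measurable_one.indicator hm).aemeasurable)
  have hleft : ∀ w ∈ O, ∫⁻ u, {p : X × K | dist (p.2 • v) p.1 ≤ r}.indicator 1 (w, u) ∂P =
      P {u | dist (u • v) v ≤ r} := by
    rintro _ ⟨g, rfl⟩
    have hset : MeasurableSet {u : K | dist (u • v) (g • v) ≤ r} :=
      measurableSet_le (hcont.measurable.dist measurable_const) measurable_const
    have : (fun u => {p : X × K | dist (p.2 • v) p.1 ≤ r}.indicator (1 : X × K → ℝ≥0∞) (g • v, u)) =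
        {u : K | dist (u • v) (g • v) ≤ r}.indicator 1 := rfl
    simp only [this]
    rw [lintegral_indicator_one hset, ← measure_preimage_mul P g]
    congr 1
    ext u
    simp [mul_smul]
  have hright : ∀ u, ∫⁻ w in O, {p : X × K | dist (p.2 • v) p.1 ≤ r}.indicator 1 (w, u) ∂μH[d] =
      μH[d] (O ∩ closedBall v r) := by
    intro u
    have : (fun w => {p : X × K | dist (p.2 • v) p.1 ≤ r}.indicator (1 : X × K → ℝ≥0∞) (w, u)) =
        (closedBall (u • v) r).indicator 1 := by
      ext w
      simp [indicator, dist_comm]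
    simp only [this]
    rw [lintegral_indicator_one isClosed_closedBall.measurableSet,
      Measure.restrict_apply isClosed_closedBall.measurableSet, inter_comm, hO,
      hausdorffMeasure_orbit_inter_closedBall_smul]
  rw [setLIntegral_congr_fun hOm hleft, lintegral_congr hright] at hswap
  simpa using hswap

/-- The invariant measure of small balls in an orbit that is almost isometric to a
`d`-dimensional normed space is asymptotic to a multiple of `r ^ d`. -/
theorem exists_tendsto_measure_dist_smul_le (P : Measure K) [IsProbabilityMeasure P]
    [P.IsMulLeftInvariant] {v : X} (hcont : Continuous fun u : K => u • v)
    {T : Type*} [NormedAddCommGroup T] [NormedSpace ℝ T] [FiniteDimensional ℝ T]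
    {α : T → X} (hα0 : α 0 = v) (hαO : ∀ x, α x ∈ MulAction.orbit K v)
    (hα : ∀ η > 0, ∃ δ > 0, ∀ x ∈ closedBall (0 : T) δ, ∀ y ∈ closedBall (0 : T) δ,
      |dist (α x) (α y) - dist x y| ≤ η * dist x y)
    (hcov : ∀ δ > 0, ∃ r₀ > 0, MulAction.orbit K v ∩ closedBall v r₀ ⊆ α '' closedBall 0 δ) :
    ∃ c > 0, Tendsto (fun r => P.real {u : K | dist (u • v) v ≤ r} / r ^ Module.finrank ℝ T)
      (𝓝[>] 0) (𝓝 c) := by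
  borelize T
  have hlim := tendsto_hausdorffMeasure_inter_closedBall hαO hα (by rwa [hα0])
  rw [hα0] at hlim
  set d := Module.finrank ℝ T
  set V := (μH[(d : ℝ)] (ball (0 : T) 1)) with hV
  have hVpos : 0 < V.toReal := ENNReal.toReal_pos (measure_ball_pos _ _ one_pos).ne'
    measure_ball_lt_top.ne
  -- Since `toReal` sends both `0` and `⊤` to `0`, one radius with positive ratio shows that the
  -- measure there is nonzero and finite.
  obtain ⟨r, hr1, hr0⟩ := ((hlim.eventually_const_lt hVpos).and self_mem_nhdsWithin).exists
  have hr0 : 0 < r := hr0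
  have hfin : μH[(d : ℝ)] (MulAction.orbit K v ∩ closedBall v r) ≠ ⊤ := by
    intro h
    simp [h] at hr1
  have hfinO := hausdorffMeasure_orbit_lt_top hcont hr0 hfin
  have hpos : 0 < (μH[(d : ℝ)] (MulAction.orbit K v)).toReal := by
    refine ENNReal.toReal_pos (fun h => ?_) hfinO
    have h0 : μH[(d : ℝ)] (MulAction.orbit K v ∩ closedBall v r) = 0 :=
      measure_mono_null inter_subset_left h
    simp [h0] at hr1
  refine ⟨V.toReal / (μH[(d : ℝ)] (MulAction.orbit K v)).toReal, by positivity, ?_⟩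
  refine (hlim.div_const _).congr fun s => ?_
  rw [← measure_dist_smul_le_mul_hausdorffMeasure_orbit P hcont hfinO s, ENNReal.toReal_mul,
    measureReal_def]
  field_simp

end HausdorffOrbit

/-! ### Existence and smoothness of one-parameter subgroups -/

section OneParameterSubgroups

open Set

theorem map_zero_of_map_add {K : Type*} [Group K] {γ : ℝ → K}
    (h : ∀ s t, γ (s + t) = γ s * γ t) : γ 0 = 1 := by
  have := h 0 0
  rwa [add_zero, left_eq_mul] at this

variable {E : Type*} [NormedAddCommGroup E] [NormedSpace ℝ E]
  {K : Type*} [TopologicalSpace K] [ChartedSpace E K]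

theorem smulRight_one_map (A : E →L[ℝ] E) (w : E) :
    (1 : ℝ →L[ℝ] ℝ).smulRight (A w) = A.comp ((1 : ℝ →L[ℝ] ℝ).smulRight w) := by
  ext
  simp

theorem hasDerivAt_extChartAt_comp_of_mdifferentiableAt {γ : ℝ → K} {t : ℝ}
    (hγ : MDifferentiableAt 𝓘(ℝ, ℝ) 𝓘(ℝ, E) γ t) {x : K} (hx : γ t = x) :
    HasDerivAt (extChartAt 𝓘(ℝ, E) x ∘ γ) (mfderiv 𝓘(ℝ, ℝ) 𝓘(ℝ, E) γ t (1 : ℝ) : E) t := by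
  subst hx
  have h := hγ.hasMFDerivAt.2
  simp only [writtenInExtChartAt, extChartAt_model_space_eq_id, PartialEquiv.refl_symm,
    PartialEquiv.refl_coe, Function.comp_id, id_eq, modelWithCornersSelf_coe, range_id] at h
  obtain ⟨D, hD⟩ : ∃ D : ℝ →L[ℝ] E, D = mfderiv 𝓘(ℝ, ℝ) 𝓘(ℝ, E) γ t := ⟨_, rfl⟩
  rw [← hD] at h ⊢
  have h' : HasFDerivAt (extChartAt 𝓘(ℝ, E) (γ t) ∘ γ) D t := hasFDerivWithinAt_univ.1 h
  exact h'.hasDerivAt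

variable [Group K]

/-- `γ` is a smooth one-parameter subgroup of `K` with initial velocity `X`. -/
structure IsOneParameterSubgroup (E : Type*) [NormedAddCommGroup E] [NormedSpace ℝ E]
    {K : Type*} [TopologicalSpace K] [ChartedSpace E K] [Group K] (γ : ℝ → K) (X : E) : Prop where
  add : ∀ s t, γ (s + t) = γ s * γ t
  contMDiff : ContMDiff 𝓘(ℝ, ℝ) 𝓘(ℝ, E) ∞ γ
  mfderiv_eq : X = (mfderiv 𝓘(ℝ, ℝ) 𝓘(ℝ, E) γ 0 (1 : ℝ) : E)


namespace IsOneParameterSubgroup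

variable {γ : ℝ → K} {X : E}

theorem map_zero (h : IsOneParameterSubgroup E γ X) : γ 0 = 1 := map_zero_of_map_add h.add

theorem hasDerivAt_extChartAt (h : IsOneParameterSubgroup E γ X) :
    HasDerivAt (extChartAt 𝓘(ℝ, E) (1 : K) ∘ γ) X 0 := by
  rw [h.mfderiv_eq]
  exact hasDerivAt_extChartAt_comp_of_mdifferentiableAt
    (h.contMDiff.mdifferentiable (by simp) 0) h.map_zero

end IsOneParameterSubgroup

section Existence

variable [LieGroup 𝓘(ℝ, E) ∞ K]

/-- Multiplication of the Lie group `K` in the chart around the identity. -/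
def chartMul (E : Type*) [NormedAddCommGroup E] [NormedSpace ℝ E]
    (K : Type*) [TopologicalSpace K] [ChartedSpace E K] [Group K] (p : E × E) : E :=
  extChartAt 𝓘(ℝ, E) (1 : K)
    ((extChartAt 𝓘(ℝ, E) (1 : K)).symm p.1 * (extChartAt 𝓘(ℝ, E) (1 : K)).symm p.2)

theorem contMDiffAt_extChartAt_symm_one :
    ContMDiffAt 𝓘(ℝ, E) 𝓘(ℝ, E) ∞ (extChartAt 𝓘(ℝ, E) (1 : K)).symm
      (extChartAt 𝓘(ℝ, E) (1 : K) 1) := by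
  have : IsManifold 𝓘(ℝ, E) ∞ K := ContMDiffMul.toIsManifold
  exact (contMDiffOn_extChartAt_symm (1 : K)).contMDiffAt
    (extChartAt_target_mem_nhds (I := 𝓘(ℝ, E)) (1 : K))

theorem contMDiffAt_extChartAt_one :
    ContMDiffAt 𝓘(ℝ, E) 𝓘(ℝ, E) ∞ (extChartAt 𝓘(ℝ, E) (1 : K)) 1 := by
  have : IsManifold 𝓘(ℝ, E) ∞ K := ContMDiffMul.toIsManifold
  exact contMDiffAt_extChartAt

theorem contDiffAt_chartMul :
    ContDiffAt ℝ ∞ (chartMul E K)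
      (extChartAt 𝓘(ℝ, E) (1 : K) 1, extChartAt 𝓘(ℝ, E) (1 : K) 1) := by
  rw [← contMDiffAt_iff_contDiffAt]
  set c := extChartAt 𝓘(ℝ, E) (1 : K)
  have h1 : ContMDiffAt 𝓘(ℝ, E × E) 𝓘(ℝ, E) ∞ (fun p : E × E => c.symm p.1) (c 1, c 1) :=
    ContMDiffAt.comp (c 1, c 1) (contMDiffAt_extChartAt_symm_one (E := E) (K := K))
      contDiff_fst.contMDiff.contMDiffAt
  have h2 : ContMDiffAt 𝓘(ℝ, E × E) 𝓘(ℝ, E) ∞ (fun p : E × E => c.symm p.2) (c 1, c 1) :=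
    ContMDiffAt.comp (c 1, c 1) (contMDiffAt_extChartAt_symm_one (E := E) (K := K))
      contDiff_snd.contMDiff.contMDiffAt
  have h3 := h1.mul h2
  refine ContMDiffAt.comp_of_eq contMDiffAt_extChartAt_one h3 ?_
  change c.symm (c 1) * c.symm (c 1) = 1
  rw [c.left_inv (mem_extChartAt_source 1), mul_one]

/-- A differentiable one-parameter subgroup of a Lie group is smooth. -/
theorem contMDiff_of_map_add [CompleteSpace E] {γ : ℝ → K} (hadd : ∀ s t, γ (s + t) = γ s * γ t)
    (hγ : MDifferentiable 𝓘(ℝ, ℝ) 𝓘(ℝ, E) γ) : ContMDiff 𝓘(ℝ, ℝ) 𝓘(ℝ, E) ∞ γ := by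
  have hzero := map_zero_of_map_add hadd
  have hcont : Continuous γ := hγ.continuous
  set c := extChartAt 𝓘(ℝ, E) (1 : K) with hc
  set X : E := mfderiv 𝓘(ℝ, ℝ) 𝓘(ℝ, E) γ 0 (1 : ℝ)
  -- The left-invariant vector field of `X` in the chart. Differentiating `γ s = γ t * γ (s - t)` at
  -- `s = t` gives the autonomous equation `y' = f y` for `y = c ∘ γ`, and smoothness of `f` passes
  -- to its solutions.
  set f : E → E := fun x => fderiv ℝ (chartMul E K) (x, c 1) (0, X) with hf
  have hfsmooth : ContDiffAt ℝ ∞ f (c 1) := by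
    have h1 : ContDiffAt ℝ ∞ (fderiv ℝ (chartMul E K)) (c 1, c 1) :=
      contDiffAt_chartMul.fderiv_right (by simp)
    have h2 : ContDiffAt ℝ ∞ (fun x : E => fderiv ℝ (chartMul E K) (x, c 1)) (c 1) :=
      ContDiffAt.comp (f := fun x : E => (x, c 1)) (c 1) h1
        (contDiffAt_id.prodMk contDiffAt_const)
    exact h2.clm_apply contDiffAt_const
  have hsrc : ∀ᶠ t in 𝓝 (0 : ℝ), γ t ∈ c.source := by
    refine hcont.continuousAt.eventually ?_
    rw [hzero]
    exact extChartAt_source_mem_nhds (I := 𝓘(ℝ, E)) (1 : K)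
  have hy0 : HasDerivAt (c ∘ γ) X 0 :=
    hasDerivAt_extChartAt_comp_of_mdifferentiableAt (hγ 0) hzero
  have hycont : ContinuousAt (c ∘ γ) 0 := hy0.continuousAt
  have hyc : (c ∘ γ) 0 = c 1 := by rw [Function.comp, hzero]
  have hyt : Tendsto (c ∘ γ) (𝓝 0) (𝓝 (c 1)) := by
    have := hycont.tendsto
    rwa [hyc] at this
  have hdiffm : ∀ᶠ x in 𝓝 (c 1), DifferentiableAt ℝ (chartMul E K) (x, c 1) := by
    have h1 : ∀ᶠ p in 𝓝 (c 1, c 1), ContDiffAt ℝ 1 (chartMul E K) p :=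
      (contDiffAt_chartMul.of_le (by simp) : ContDiffAt ℝ 1 (chartMul E K) (c 1, c 1)).eventually
        (by simp)
    have h2 : Tendsto (fun x : E => (x, c 1)) (𝓝 (c 1)) (𝓝 (c 1, c 1)) :=
      Continuous.tendsto (by fun_prop) _
    filter_upwards [h2.eventually h1] with x hx using hx.differentiableAt (by simp)
  have hyderiv : ∀ᶠ t in 𝓝 (0 : ℝ), HasDerivAt (c ∘ γ) (f ((c ∘ γ) t)) t := by
    have h2 : ∀ᶠ t in 𝓝 (0 : ℝ), DifferentiableAt ℝ (chartMul E K) ((c ∘ γ) t, c 1) := by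
      exact hyt.eventually hdiffm
    filter_upwards [hsrc, h2] with t ht hdt
    have h3 : HasDerivAt (fun s : ℝ => ((c ∘ γ) t, (c ∘ γ) (s - t))) ((0 : E), X) t := by
      refine (hasDerivAt_const t _).prodMk ?_
      refine HasDerivAt.comp_sub_const t t ?_
      rwa [sub_self]
    have h4 : HasFDerivAt (chartMul E K) (fderiv ℝ (chartMul E K) ((c ∘ γ) t, c 1))
        ((c ∘ γ) t, (c ∘ γ) (t - t)) := by
      rw [sub_self, hyc]
      exact hdt.hasFDerivAt
    have h5 := h4.comp_hasDerivAt t h3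
    refine h5.congr_of_eventuallyEq ?_
    have h6 : ∀ᶠ s in 𝓝 t, γ (s - t) ∈ c.source := by
      have : Tendsto (fun s : ℝ => s - t) (𝓝 t) (𝓝 0) := by
        have : Continuous fun s : ℝ => s - t := by fun_prop
        simpa using this.tendsto t
      exact this.eventually hsrc
    filter_upwards [h6] with s hs
    change c (γ s) = c (c.symm (c (γ t)) * c.symm (c (γ (s - t))))
    rw [c.left_inv ht, c.left_inv hs, ← hadd, add_sub_cancel]
  have hysmooth : ContDiffAt ℝ ∞ (c ∘ γ) 0 := by
    rw [contDiffAt_infty]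
    intro n
    obtain ⟨u, hu, hfu⟩ : ∃ u ∈ 𝓝 (c 1), ContDiffOn ℝ n f u := by
      have h1 : ContDiffAt ℝ n f (c 1) := hfsmooth.of_le (by exact_mod_cast le_top)
      have h2 := h1.eventually (by simp)
      exact ⟨_, h2, fun x hx => ContDiffAt.contDiffWithinAt hx⟩
    have hmem : ∀ᶠ t in 𝓝 (0 : ℝ), (c ∘ γ) t ∈ u := by
      exact hyt.eventually hu
    obtain ⟨ε, hε, hball⟩ := Metric.eventually_nhds_iff_ball.1 (hmem.and hyderiv)
    have hIcc : Icc (-(ε / 2)) (ε / 2) ⊆ Metric.ball (0 : ℝ) ε := by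
      intro t ht
      rw [mem_ball_zero_iff, Real.norm_eq_abs, abs_lt]
      constructor <;> linarith [ht.1, ht.2]
    have h3 : ContDiffOn ℝ n (c ∘ γ) (Icc (-(ε / 2)) (ε / 2)) := by
      refine ODE.contDiffOn_enat_Icc_of_hasDerivWithinAt (n := (n : ℕ∞)) (f := fun _ x => f x)
        (u := u) (hfu.comp contDiffOn_snd fun p hp => hp.2) (fun t ht => ?_) fun t ht => ?_
      · exact (hball t (hIcc ht)).2.hasDerivWithinAt
      · exact (hball t (hIcc ht)).1
    exact h3.contDiffAt (Icc_mem_nhds (by linarith) (by linarith))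
  have h0 : ContMDiffAt 𝓘(ℝ, ℝ) 𝓘(ℝ, E) ∞ γ 0 := by
    have h1 : ContMDiffAt 𝓘(ℝ, ℝ) 𝓘(ℝ, E) ∞ (c.symm ∘ (c ∘ γ)) 0 :=
      ContMDiffAt.comp_of_eq (contMDiffAt_extChartAt_symm_one (E := E) (K := K))
        hysmooth.contMDiffAt hyc
    refine h1.congr_of_eventuallyEq ?_
    filter_upwards [hsrc] with t ht
    exact (c.left_inv ht).symm
  intro t
  -- Left translation carries smoothness at `0` to smoothness at `t`.
  have h2 : γ = (fun g => γ t * g) ∘ γ ∘ fun s => s - t := by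
    ext s
    simp only [Function.comp]
    rw [← hadd, add_sub_cancel]
  rw [h2]
  refine (contMDiff_mul_left (I := 𝓘(ℝ, E)) (n := ∞) (a := γ t)).contMDiffAt.comp t ?_
  refine ContMDiffAt.comp_of_eq h0 ?_ (sub_self t)
  exact (contDiff_id.sub contDiff_const).contMDiff.contMDiffAt

/-- Every element of the Lie algebra is the velocity of a one-parameter subgroup. -/
theorem exists_isOneParameterSubgroup [CompleteSpace E] [T2Space K] (X : E) :
    ∃ γ : ℝ → K, IsOneParameterSubgroup E γ X := by
  have hLG : LieGroup 𝓘(ℝ, E) (minSmoothness ℝ 3) K :=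
    LieGroup.of_le (n := ∞) (by
      rw [minSmoothness_of_isRCLikeNormedField]
      exact ENat.LEInfty.out)
  have hM1 : IsManifold 𝓘(ℝ, E) 1 K := by
    have : IsManifold 𝓘(ℝ, E) ∞ K := ContMDiffMul.toIsManifold
    exact IsManifold.of_le (n := ∞) (by simp)
  let w : (g : K) → TangentSpace 𝓘(ℝ, E) g :=
    mulInvariantVectorField (I := 𝓘(ℝ, E)) (G := K) X
  have hw : CMDiff 1 (fun g : K => (⟨g, w g⟩ : TangentBundle 𝓘(ℝ, E) K)) :=
    (contMDiff_mulInvariantVectorField (I := 𝓘(ℝ, E)) (G := K) X).of_le (by simp)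
  have hmd : ∀ g h : K, MDifferentiableAt 𝓘(ℝ, E) 𝓘(ℝ, E) (fun x => g * x) h := fun g h =>
    (contMDiff_mul_left (I := 𝓘(ℝ, E)) (n := ∞) (a := g)).mdifferentiable (by simp) h
  have hinv : ∀ g h : K, mfderiv 𝓘(ℝ, E) 𝓘(ℝ, E) (fun x => g * x) h (w h) = w (g * h) := by
    intro g h
    change mfderiv 𝓘(ℝ, E) 𝓘(ℝ, E) (fun x => g * x) h
      (mfderiv 𝓘(ℝ, E) 𝓘(ℝ, E) (fun x => h * x) 1 X) =
      mfderiv 𝓘(ℝ, E) 𝓘(ℝ, E) (fun x => g * h * x) 1 X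
    have h1 : (fun x => g * h * x) = (fun x => g * x) ∘ fun x => h * x := by
      ext x
      simp [mul_assoc]
    rw [h1, mfderiv_comp_of_eq (hmd g h) (hmd h 1) (mul_one h), mul_one]
    rfl
  have htrans : ∀ (g : K) (γ : ℝ → K) (s : Set ℝ), IsMIntegralCurveOn γ w s →
      IsMIntegralCurveOn (fun t => g * γ t) w s := by
    intro g γ s hγ t ht
    have h1 := (hmd g (γ t)).hasMFDerivAt.comp_hasMFDerivWithinAt t (hγ t ht)
    have h2 : ((1 : ℝ →L[ℝ] ℝ).smulRight (w (g * γ t)) : ℝ →L[ℝ] E) =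
        (mfderiv 𝓘(ℝ, E) 𝓘(ℝ, E) (fun x => g * x) (γ t) : E →L[ℝ] E).comp
          ((1 : ℝ →L[ℝ] ℝ).smulRight (w (γ t) : E)) := by
      rw [← hinv]
      exact smulRight_one_map (E := E) (mfderiv 𝓘(ℝ, E) 𝓘(ℝ, E) (fun x => g * x) (γ t) : E →L[ℝ] E)
        (w (γ t) : E)
    exact h2 ▸ h1
  obtain ⟨γ₀, hγ₀, hγ₀'⟩ := exists_isMIntegralCurveAt_of_contMDiffAt_boundaryless
    (t₀ := (0 : ℝ)) (hw.contMDiffAt (x := (1 : K)))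
  obtain ⟨ε, hε, hγε⟩ := isMIntegralCurveAt_iff'.1 hγ₀'
  rw [Real.ball_eq_Ioo, zero_sub, zero_add] at hγε
  -- Left translates of the local curve through `1` start at every point and live for the same time
  -- `ε`, so the integral curve extends to all of `ℝ`.
  obtain ⟨γ, hγ1, hγ⟩ := exists_isMIntegralCurve_of_isMIntegralCurveOn hw hε
    (fun g => ⟨fun t => g * γ₀ t, by simp [hγ₀], htrans g _ _ hγε⟩) 1
  -- As functions of `t`, both sides are integral curves starting at `γ s`; uniqueness identifies
  -- them.
  have hadd : ∀ s t, γ (s + t) = γ s * γ t := by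
    intro s t
    have h1 : IsMIntegralCurve (fun t => γ s * γ t) w := by
      rw [isMIntegralCurve_iff_isMIntegralCurveOn] at hγ ⊢
      exact htrans _ _ _ hγ
    have h2 : IsMIntegralCurve (γ ∘ fun t => t + s) w := hγ.comp_add s
    have h3 := isMIntegralCurve_Ioo_eq_of_contMDiff_boundaryless (t₀ := 0) hw h2 h1
      (by simp [hγ1])
    have := congrFun h3 t
    rw [add_comm]
    exact this
  refine ⟨γ, hadd, contMDiff_of_map_add hadd fun t => (hγ t).mdifferentiableAt, ?_⟩
  rw [(hγ 0).mfderiv]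
  have h1 : ∀ g : K, g = 1 → (X : E) = (w g : E) := by
    rintro _ rfl
    change X = mfderiv 𝓘(ℝ, E) 𝓘(ℝ, E) (fun x : K => 1 * x) 1 X
    have : (fun x : K => 1 * x) = id := by
      ext x
      simp
    rw [this, mfderiv_id]
    rfl
  rw [h1 _ hγ1]
  exact (one_smul ℝ _).symm

end Existence

end OneParameterSubgroups

/-! ### Coordinates near the identity from products of one-parameter subgroups -/

section OneParameterProducts

open Set

theorem List.prod_ofFn_of_forall_ne_eq_one {M : Type*} [Monoid M] {n : ℕ} (f : Fin n → M)
    (i : Fin n) (h : ∀ j, j ≠ i → f j = 1) : (List.ofFn f).prod = f i := by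
  induction n with
  | zero => exact i.elim0
  | succ n ih =>
    rw [List.ofFn_succ, List.prod_cons]
    refine Fin.cases (motive := fun i => (∀ j, j ≠ i → f j = 1) → _ = f i) ?_ ?_ i h
    · intro h
      have : (List.ofFn fun j : Fin n => f j.succ).prod = 1 := by
        refine List.prod_eq_one fun x hx => ?_
        obtain ⟨j, rfl⟩ := List.mem_ofFn.1 hx
        exact h _ (Fin.succ_ne_zero j)
      rw [this, mul_one]
    · intro i h
      rw [h 0 (Fin.succ_ne_zero i).symm, one_mul]
      exact ih (fun j => f j.succ) i fun j hj => h _ ((Fin.succ_injective _).ne hj)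

variable {E : Type*} [NormedAddCommGroup E] [NormedSpace ℝ E]
  {K : Type*} [TopologicalSpace K] [ChartedSpace E K] [Group K]

/-- The ordered product of the values of finitely many curves in a group. -/
def orderedProd {n : ℕ} (γ : Fin n → ℝ → K) (t : Fin n → ℝ) : K :=
  (List.ofFn fun i => γ i (t i)).prod

variable {n : ℕ} {γ : Fin n → ℝ → K} {X : Fin n → E}

theorem orderedProd_zero (h : ∀ i, IsOneParameterSubgroup E (γ i) (X i)) :
    orderedProd γ 0 = 1 := by
  refine List.prod_eq_one fun x hx => ?_
  obtain ⟨j, rfl⟩ := List.mem_ofFn.1 hx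
  exact (h j).map_zero

theorem orderedProd_single (h : ∀ i, IsOneParameterSubgroup E (γ i) (X i)) (i : Fin n) (s : ℝ) :
    orderedProd γ (Pi.single i s) = γ i s := by
  rw [orderedProd, List.prod_ofFn_of_forall_ne_eq_one _ i, Pi.single_eq_same]
  intro j hj
  rw [Pi.single_eq_of_ne hj, (h j).map_zero]

variable [LieGroup 𝓘(ℝ, E) ∞ K]

theorem contMDiff_orderedProd (h : ∀ i, IsOneParameterSubgroup E (γ i) (X i)) :
    ContMDiff 𝓘(ℝ, Fin n → ℝ) 𝓘(ℝ, E) ∞ (orderedProd γ) := by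
  induction n with
  | zero =>
    have : orderedProd γ = fun _ => (1 : K) := by
      ext t
      simp [orderedProd]
    rw [this]
    exact contMDiff_const
  | succ n ih =>
    have : orderedProd γ = fun t => γ 0 (t 0) * orderedProd (fun i => γ i.succ)
        (fun i => t i.succ) := by
      ext t
      simp [orderedProd, List.ofFn_succ]
    rw [this]
    have h1 : ContMDiff 𝓘(ℝ, Fin (n + 1) → ℝ) 𝓘(ℝ, E) ∞ fun t : Fin (n + 1) → ℝ => γ 0 (t 0) :=
      (h 0).contMDiff.comp (contDiff_apply ℝ ℝ (0 : Fin (n + 1))).contMDiff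
    have h2 : ContDiff ℝ ∞ fun (t : Fin (n + 1) → ℝ) (i : Fin n) => t i.succ :=
      contDiff_pi.2 fun i => contDiff_apply ℝ ℝ i.succ
    exact h1.mul ((ih fun i => h i.succ).comp h2.contMDiff)

/-- Products of one-parameter subgroups whose velocities span the Lie algebra
cover a neighbourhood of the identity. -/
theorem nhds_one_le_map_orderedProd_mul [FiniteDimensional ℝ E] {p q : ℕ}
    {γ : Fin p → ℝ → K} {X : Fin p → E}
    (hγ : ∀ i, IsOneParameterSubgroup E (γ i) (X i)) {γ' : Fin q → ℝ → K} {Y : Fin q → E}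
    (hγ' : ∀ i, IsOneParameterSubgroup E (γ' i) (Y i))
    (hspan : Submodule.span ℝ (range X) ⊔ Submodule.span ℝ (range Y) = ⊤) :
    𝓝 (1 : K) ≤ map (fun t : (Fin p → ℝ) × (Fin q → ℝ) => orderedProd γ t.1 * orderedProd γ' t.2)
      (𝓝 0) := by
  set c := extChartAt 𝓘(ℝ, E) (1 : K) with hc
  set Ψ : (Fin p → ℝ) × (Fin q → ℝ) → K := fun t => orderedProd γ t.1 * orderedProd γ' t.2 with hΨ
  have hΨ0 : Ψ 0 = 1 := by
    simp [hΨ, orderedProd_zero hγ, orderedProd_zero hγ']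
  have hΨs : ContMDiff 𝓘(ℝ, (Fin p → ℝ) × (Fin q → ℝ)) 𝓘(ℝ, E) ∞ Ψ :=
    ((contMDiff_orderedProd hγ).comp contDiff_fst.contMDiff).mul
      ((contMDiff_orderedProd hγ').comp contDiff_snd.contMDiff)
  have hys : ContDiffAt ℝ ∞ (c ∘ Ψ) 0 := by
    rw [← contMDiffAt_iff_contDiffAt]
    exact ContMDiffAt.comp_of_eq contMDiffAt_extChartAt_one hΨs.contMDiffAt hΨ0
  have hstrict := hys.hasStrictFDerivAt (by simp)
  set A := fderiv ℝ (c ∘ Ψ) 0 with hA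
  -- On a coordinate axis all factors but one are `1`, so the derivative sends the basis vectors to
  -- the given velocities. Since these span, the derivative is surjective and the map is open at
  -- `0`.
  have hX : ∀ i, A (Pi.single i 1, 0) = X i := by
    intro i
    have h1 : HasDerivAt (fun s : ℝ => ((Pi.single i s, 0) : (Fin p → ℝ) × (Fin q → ℝ)))
        (Pi.single i 1, 0) 0 := by
      refine HasDerivAt.prodMk ?_ (hasDerivAt_const _ _)
      exact (ContinuousLinearMap.single ℝ (fun _ : Fin p => ℝ) i).hasDerivAt
    have h2 := HasFDerivAt.comp_hasDerivAt_of_eq (0 : ℝ) hstrict.hasFDerivAt h1 (by simp; rfl)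
    have h3 : (c ∘ Ψ) ∘ (fun s : ℝ => ((Pi.single i s, 0) : (Fin p → ℝ) × (Fin q → ℝ))) =
        c ∘ γ i := by
      ext s
      simp [hΨ, orderedProd_zero hγ', orderedProd_single hγ]
    rw [h3] at h2
    exact h2.unique (hγ i).hasDerivAt_extChartAt
  have hY : ∀ i, A (0, Pi.single i 1) = Y i := by
    intro i
    have h1 : HasDerivAt (fun s : ℝ => ((0, Pi.single i s) : (Fin p → ℝ) × (Fin q → ℝ)))
        (0, Pi.single i 1) 0 := by
      refine HasDerivAt.prodMk (hasDerivAt_const _ _) ?_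
      exact (ContinuousLinearMap.single ℝ (fun _ : Fin q => ℝ) i).hasDerivAt
    have h2 := HasFDerivAt.comp_hasDerivAt_of_eq (0 : ℝ) hstrict.hasFDerivAt h1 (by simp; rfl)
    have h3 : (c ∘ Ψ) ∘ (fun s : ℝ => ((0, Pi.single i s) : (Fin p → ℝ) × (Fin q → ℝ))) =
        c ∘ γ' i := by
      ext s
      simp [hΨ, orderedProd_zero hγ, orderedProd_single hγ']
    rw [h3] at h2
    exact h2.unique (hγ' i).hasDerivAt_extChartAt
  have hsurj : A.range = ⊤ := by
    rw [← top_le_iff, ← hspan]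
    refine sup_le (Submodule.span_le.2 ?_) (Submodule.span_le.2 ?_)
    · rintro _ ⟨i, rfl⟩
      exact ⟨_, hX i⟩
    · rintro _ ⟨i, rfl⟩
      exact ⟨_, hY i⟩
  have hmap := hstrict.map_nhds_eq_of_surj hsurj
  have hy0 : (c ∘ Ψ) 0 = c 1 := by rw [Function.comp, hΨ0]
  rw [hy0] at hmap
  intro N hN
  have hsrc : ∀ᶠ t in 𝓝 0, Ψ t ∈ c.source := by
    have := hΨs.continuous.tendsto 0
    rw [hΨ0] at this
    exact this.eventually (extChartAt_source_mem_nhds (I := 𝓘(ℝ, E)) (1 : K))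
  have himg : (c ∘ Ψ) '' (Ψ ⁻¹' N ∩ {t | Ψ t ∈ c.source}) ∈ 𝓝 (c 1) := by
    rw [← hmap]
    exact image_mem_map (inter_mem hN hsrc)
  filter_upwards [(continuousAt_extChartAt (I := 𝓘(ℝ, E)) (1 : K)).preimage_mem_nhds himg,
    extChartAt_source_mem_nhds (I := 𝓘(ℝ, E)) (1 : K)] with g hg hgs
  obtain ⟨t, ⟨htN, hts⟩, ht⟩ := hg
  have : Ψ t = g := c.injOn hts hgs ht
  exact this ▸ htN

end OneParameterProducts

/-! ### Openness of the orbit map of a compact group -/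

section OrbitMap

open Set
open scoped Pointwise

/-- In a compact group, points of an orbit close to `v` are images of `v` under elements
close to the identity. -/
theorem exists_dist_lt_imp_exists_smul_eq {K X : Type*} [TopologicalSpace K] [Group K]
    [IsTopologicalGroup K] [CompactSpace K] [MetricSpace X] [MulAction K X] {v : X}
    (hcont : Continuous fun u : K => u • v) {N : Set K} (hN : N ∈ 𝓝 1) :
    ∃ r > 0, ∀ u : K, dist (u • v) v ≤ r → ∃ u' ∈ N, u' • v = u • v := by
  obtain ⟨W, hWN, hW, h1W⟩ := mem_nhds_iff.1 hN
  set S : Set K := {s | s • v = v}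
  have hopen : IsOpen (W * S) := hW.mul_right
  -- Outside the neighbourhood `W * S` of the stabilizer, compactness bounds the distance from `u •
  -- v` to `v` below; on `W * S` the factor in `S` can be dropped.
  have hcl : IsCompact (W * S)ᶜ := hopen.isClosed_compl.isCompact
  have hpos : ∀ u ∈ (W * S)ᶜ, 0 < dist (u • v) v := by
    intro u hu
    refine dist_pos.2 fun h => hu ?_
    exact ⟨1, h1W, u, h, one_mul u⟩
  obtain ⟨r, hr, hrS⟩ := hcl.exists_forall_le' (f := fun u => dist (u • v) v)
    (hcont.dist continuous_const).continuousOn hpos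
  refine ⟨r / 2, by linarith, fun u hu => ?_⟩
  have : u ∈ W * S := by
    by_contra h
    have := hrS u h
    linarith
  obtain ⟨w, hw, s, hs, rfl⟩ := this
  have hs : s • v = v := hs
  refine ⟨w, hWN hw, ?_⟩
  rw [mul_smul, hs]

end OrbitMap

/-! ### Infinitesimal action and the consequences of a vanishing moment map -/

section InfinitesimalAction

open Set

variable {E : Type*} [NormedAddCommGroup E] [NormedSpace ℝ E]
  {K : Type*} [TopologicalSpace K] [ChartedSpace E K] [Group K]
  {V : Type*} [NormedAddCommGroup V] [InnerProductSpace ℂ V] [FiniteDimensional ℂ V]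
  (π : Representation ℂ K V)

/-- The differential at the identity of a representation of a real Lie group. -/
def Representation.realInfinitesimal (E : Type*) [NormedAddCommGroup E] [NormedSpace ℝ E]
    {K : Type*} [TopologicalSpace K] [ChartedSpace E K] [Group K] (π : Representation ℂ K V) :
    E →L[ℝ] (V →L[ℂ] V) :=
  mfderiv 𝓘(ℝ, E) 𝓘(ℝ, V →L[ℂ] V) π.toEnd 1

variable {π}

theorem hasFDerivAt_toEnd_comp (hπ : MDifferentiable 𝓘(ℝ, E) 𝓘(ℝ, V →L[ℂ] V) π.toEnd)
    {W : Type*} [NormedAddCommGroup W] [NormedSpace ℝ W] {f : W → K} {w : W}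
    (hf : MDifferentiableAt 𝓘(ℝ, W) 𝓘(ℝ, E) f w) (hw : f w = 1) :
    HasFDerivAt (fun x => π.toEnd (f x)) ((π.realInfinitesimal E).comp
      (mfderiv 𝓘(ℝ, W) 𝓘(ℝ, E) f w : W →L[ℝ] E)) w := by
  have key : ∀ g, f w = g → HasMFDerivAt 𝓘(ℝ, W) 𝓘(ℝ, V →L[ℂ] V) (π.toEnd ∘ f) w
      ((mfderiv 𝓘(ℝ, E) 𝓘(ℝ, V →L[ℂ] V) π.toEnd g : E →L[ℝ] (V →L[ℂ] V)).comp
        (mfderiv 𝓘(ℝ, W) 𝓘(ℝ, E) f w : W →L[ℝ] E)) := by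
    rintro _ rfl
    exact (hπ (f w)).hasMFDerivAt.comp w hf.hasMFDerivAt
  exact (key 1 hw).hasFDerivAt

theorem IsOneParameterSubgroup.hasDerivAt_toEnd
    (hπ : MDifferentiable 𝓘(ℝ, E) 𝓘(ℝ, V →L[ℂ] V) π.toEnd)
    {γ : ℝ → K} {X : E} (hγ : IsOneParameterSubgroup E γ X) :
    HasDerivAt (fun t => π.toEnd (γ t)) (π.realInfinitesimal E X) 0 := by
  have h := (hasFDerivAt_toEnd_comp hπ (hγ.contMDiff.mdifferentiable (by simp) 0)
    hγ.map_zero).hasDerivAt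
  rw [hγ.mfderiv_eq]
  exact h

theorem IsOneParameterSubgroup.hasDerivAt_apply
    (hπ : MDifferentiable 𝓘(ℝ, E) 𝓘(ℝ, V →L[ℂ] V) π.toEnd)
    {γ : ℝ → K} {X : E} (hγ : IsOneParameterSubgroup E γ X) (x : V) :
    HasDerivAt (fun t => π (γ t) x) (π.realInfinitesimal E X x) 0 :=
  ((ContinuousLinearMap.apply ℂ V x).restrictScalars ℝ).hasFDerivAt.comp_hasDerivAt (0 : ℝ)
    (hγ.hasDerivAt_toEnd hπ)

/-- The homomorphism property moves the derivative at `0` to time `t`. -/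
theorem IsOneParameterSubgroup.hasDerivAt_apply'
    (hπ : MDifferentiable 𝓘(ℝ, E) 𝓘(ℝ, V →L[ℂ] V) π.toEnd)
    {γ : ℝ → K} {X : E} (hγ : IsOneParameterSubgroup E γ X) (x : V) (t : ℝ) :
    HasDerivAt (fun t => π (γ t) x) (π (γ t) (π.realInfinitesimal E X x)) t := by
  have h1 : HasDerivAt (fun s : ℝ => π (γ (s - t)) x) (π.realInfinitesimal E X x) t := by
    refine HasDerivAt.comp_sub_const (f := fun s => π (γ s) x) t t ?_
    rw [sub_self]
    exact hγ.hasDerivAt_apply hπ x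
  have h2 := ((π.toEnd (γ t)).restrictScalars ℝ).hasFDerivAt.comp_hasDerivAt t h1
  refine h2.congr_of_eventuallyEq (Eventually.of_forall fun s => ?_)
  change π (γ s) x = π (γ t) (π (γ (s - t)) x)
  rw [← Module.End.mul_apply, ← map_mul, ← hγ.add, add_sub_cancel]

theorem IsOneParameterSubgroup.apply_eq_self
    (hπ : MDifferentiable 𝓘(ℝ, E) 𝓘(ℝ, V →L[ℂ] V) π.toEnd)
    {γ : ℝ → K} {X : E} (hγ : IsOneParameterSubgroup E γ X) {x : V}
    (hX : π.realInfinitesimal E X x = 0) (t : ℝ) : π (γ t) x = x := by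
  have hd : ∀ s, HasDerivAt (fun t => π (γ t) x) 0 s := by
    intro s
    have := hγ.hasDerivAt_apply' hπ x s
    rwa [hX, _root_.map_zero] at this
  have := is_const_of_deriv_eq_zero (fun s => (hd s).differentiableAt) (fun s => (hd s).deriv) t 0
  simpa [hγ.map_zero] using this

variable (hπ : MDifferentiable 𝓘(ℝ, E) 𝓘(ℝ, V →L[ℂ] V) π.toEnd)

include hπ

/-- When the inner products `⟪v, Φ(X) v⟫` vanish, the matrix coefficient of `v` is stationary
at the identity. -/
theorem hasFDerivAt_inner_toEnd_comp {v : V}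
    (hμ : ∀ X, inner ℂ v (π.realInfinitesimal E X v) = 0)
    {W : Type*} [NormedAddCommGroup W] [NormedSpace ℝ W] {f : W → K} {w : W}
    (hf : MDifferentiableAt 𝓘(ℝ, W) 𝓘(ℝ, E) f w) (hw : f w = 1) :
    HasFDerivAt (fun x => inner ℂ v (π (f x) v)) (0 : W →L[ℝ] ℂ) w := by
  have h1 := (((innerSL ℂ v).comp (ContinuousLinearMap.apply ℂ V v)).restrictScalars
    ℝ).hasFDerivAt.comp w (hasFDerivAt_toEnd_comp hπ hf hw)
  refine h1.congr_fderiv ?_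
  ext y
  exact hμ _

/-- Equivariance of the moment map: by unitarity the coefficient of `π u v` along `γ` is that of `v`
along `u⁻¹ γ u`, which also passes through `1`, where the coefficient of `v` is stationary. -/
theorem inner_apply_realInfinitesimal_apply_eq_zero [LieGroup 𝓘(ℝ, E) ∞ K] [CompleteSpace E]
    [T2Space K] (hK : ∀ (u : K) (x y : V), inner ℂ (π u x) (π u y) = inner ℂ x y) {v : V}
    (hμ : ∀ X, inner ℂ v (π.realInfinitesimal E X v) = 0) (u : K) (Y : E) :
    inner ℂ (π u v) (π.realInfinitesimal E Y (π u v)) = 0 := by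
  obtain ⟨γ, hγ⟩ := exists_isOneParameterSubgroup (K := K) Y
  have hf : ContMDiff 𝓘(ℝ, ℝ) 𝓘(ℝ, E) ∞ (fun t => u⁻¹ * γ t * u) :=
    (contMDiff_const.mul hγ.contMDiff).mul contMDiff_const
  have h1 := (hasFDerivAt_inner_toEnd_comp hπ hμ (hf.mdifferentiable (by simp) 0)
    (by simp [hγ.map_zero])).hasDerivAt
  have h2 : HasDerivAt (fun t => inner ℂ (π u v) (π (γ t) (π u v)))
      (inner ℂ (π u v) (π.realInfinitesimal E Y (π u v))) 0 :=
    ((innerSL ℂ (π u v)).restrictScalars ℝ).hasFDerivAt.comp_hasDerivAt (0 : ℝ)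
      (hγ.hasDerivAt_apply hπ (π u v))
  have h3 : (fun t => inner ℂ v (π (u⁻¹ * γ t * u) v)) =
      fun t => inner ℂ (π u v) (π (γ t) (π u v)) := by
    ext t
    rw [← hK u v, ← Module.End.mul_apply, ← map_mul, ← mul_assoc, mul_inv_cancel_left,
      map_mul, Module.End.mul_apply]
  rw [h3] at h1
  simpa using h2.unique h1

/-- The derivative of the invariance of the inner product along a one-parameter subgroup. -/
theorem inner_realInfinitesimal_left [LieGroup 𝓘(ℝ, E) ∞ K] [CompleteSpace E]
    [T2Space K] (hK : ∀ (u : K) (x y : V), inner ℂ (π u x) (π u y) = inner ℂ x y) (X : E) (x y : V) :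
    inner ℂ (π.realInfinitesimal E X x) y = -inner ℂ x (π.realInfinitesimal E X y) := by
  obtain ⟨γ, hγ⟩ := exists_isOneParameterSubgroup (K := K) X
  have h1 := (hγ.hasDerivAt_apply hπ x).inner ℂ (hγ.hasDerivAt_apply hπ y)
  simp only [hK, hγ.map_zero, map_one, Module.End.one_apply] at h1
  have h2 := h1.unique (hasDerivAt_const (0 : ℝ) (inner ℂ x y))
  rw [add_comm] at h2
  exact eq_neg_of_add_eq_zero_left h2

/-- When the moment map vanishes, the tangent space of the orbit is isotropic. -/
theorem im_inner_realInfinitesimal_eq_zero [LieGroup 𝓘(ℝ, E) ∞ K] [CompleteSpace E]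
    [T2Space K] (hK : ∀ (u : K) (x y : V), inner ℂ (π u x) (π u y) = inner ℂ x y) {v : V}
    (hμ : ∀ X, inner ℂ v (π.realInfinitesimal E X v) = 0) (X Y : E) :
    (inner ℂ (π.realInfinitesimal E X v) (π.realInfinitesimal E Y v)).im = 0 := by
  obtain ⟨γ, hγ⟩ := exists_isOneParameterSubgroup (K := K) X
  have h1 := hγ.hasDerivAt_apply hπ v
  have h2 := ((π.realInfinitesimal E Y).restrictScalars ℝ).hasFDerivAt.comp_hasDerivAt (0 : ℝ) h1
  have h3 := h1.inner ℂ h2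
  -- Differentiating this identity at `0` gives `⟪v, Φ(Y) Φ(X) v⟫ + ⟪Φ(X) v, Φ(Y) v⟫ = 0`. Skewness
  -- of `Φ(Y)` then makes `⟪Φ(X) v, Φ(Y) v⟫` equal to its conjugate.
  have h4 : (fun t => inner ℂ (π (γ t) v) ((⇑((π.realInfinitesimal E Y).restrictScalars ℝ) ∘
      fun t => π (γ t) v) t)) = fun _ => 0 := by
    ext t
    exact inner_apply_realInfinitesimal_apply_eq_zero hπ hK hμ (γ t) Y
  rw [h4] at h3
  have h5 := h3.unique (hasDerivAt_const (0 : ℝ) (0 : ℂ))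
  simp only [Function.comp, hγ.map_zero, map_one, Module.End.one_apply,
    ContinuousLinearMap.coe_restrictScalars'] at h5
  rw [← neg_eq_iff_eq_neg.2 (inner_realInfinitesimal_left hπ hK Y v
    (π.realInfinitesimal E X v)), ← inner_conj_symm (π.realInfinitesimal E Y v)] at h5
  have := congrArg Complex.im h5
  simp only [Complex.add_im, Complex.neg_im, Complex.conj_im, neg_neg, Complex.zero_im] at this
  linarith

end InfinitesimalAction

/-! ### Parametrization of the orbit by its tangent space -/

section OrbitParametrization

open Set

variable {E : Type*} [NormedAddCommGroup E] [NormedSpace ℝ E]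
  {K : Type*} [TopologicalSpace K] [ChartedSpace E K] [Group K]
  {V : Type*} [NormedAddCommGroup V] [InnerProductSpace ℂ V] [FiniteDimensional ℂ V]

/-- The tangent map `X ↦ Φ(X) v` of the orbit map at the identity. -/
def Representation.orbitDifferential (E : Type*) [NormedAddCommGroup E] [NormedSpace ℝ E]
    {K : Type*} [TopologicalSpace K] [ChartedSpace E K] [Group K] (π : Representation ℂ K V)
    (v : V) : E →ₗ[ℝ] V :=
  ((ContinuousLinearMap.apply ℂ V v).restrictScalars ℝ).toLinearMap ∘ₗ
    (π.realInfinitesimal E).toLinearMap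

variable {π : Representation ℂ K V}

/-- The action of a group on the space of a representation. -/
@[reducible]
def Representation.toMulAction {K : Type*} [Group K] {V : Type*} [AddCommGroup V] [Module ℂ V]
    (π : Representation ℂ K V) : MulAction K V where
  smul u w := π u w
  one_smul w := by
    change π 1 w = w
    simp
  mul_smul a b w := by
    change π (a * b) w = π a (π b w)
    rw [map_mul, Module.End.mul_apply]

theorem orbitDifferential_apply (v : V) (X : E) :
    π.orbitDifferential E v X = π.realInfinitesimal E X v := rfl

theorem apply_orderedProd_eq_self {K : Type*} [Group K] {V : Type*} [AddCommGroup V] [Module ℂ V]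
    {π : Representation ℂ K V} {n : ℕ} {γ : Fin n → ℝ → K} {v : V}
    (h : ∀ i t, π (γ i t) v = v) (t : Fin n → ℝ) : π (orderedProd γ t) v = v := by
  have key : ∀ l : List K, (∀ u ∈ l, π u v = v) → π l.prod v = v := by
    intro l
    induction l with
    | nil => simp
    | cons a l ih =>
      intro hl
      rw [List.prod_cons, map_mul, Module.End.mul_apply,
        ih fun u hu => hl u (List.mem_cons_of_mem _ hu), hl a List.mem_cons_self]
  refine key _ fun u hu => ?_
  obtain ⟨i, rfl⟩ := List.mem_ofFn.1 hu
  exact h i _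

variable [LieGroup 𝓘(ℝ, E) ∞ K] [FiniteDimensional ℝ E] [T2Space K] [CompactSpace K]

/-- Near `v` the orbit of `v` is parametrized by its tangent space. -/
theorem exists_orbit_parametrization
    (hπ : ContMDiff 𝓘(ℝ, E) 𝓘(ℝ, V →L[ℂ] V) ∞ π.toEnd)
    (hK : ∀ (u : K) (x y : V), inner ℂ (π u x) (π u y) = inner ℂ x y) {v : V}
    (hμ : ∀ X, inner ℂ v (π.realInfinitesimal E X v) = 0) :
    ∃ α : (π.orbitDifferential E v).range → V, α 0 = v ∧ (∀ x, ∃ u, π u v = α x) ∧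
      ContDiff ℝ ∞ α ∧ fderiv ℝ α 0 = (π.orbitDifferential E v).range.subtypeL ∧
      (∀ x y, inner ℂ (α x) (fderiv ℝ α x y) = 0) ∧
      ∀ δ > 0, ∃ r > 0, ∀ u : K, dist (π u v) v ≤ r → ∃ x, ‖x‖ ≤ δ ∧ α x = π u v := by
  have hπd : MDifferentiable 𝓘(ℝ, E) 𝓘(ℝ, V →L[ℂ] V) π.toEnd := hπ.mdifferentiable (by simp)
  have hcompl : CompleteSpace E := FiniteDimensional.complete ℝ E
  have htg : IsTopologicalGroup K := topologicalGroup_of_lieGroup 𝓘(ℝ, E) ∞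
  set A := π.orbitDifferential E v with hA
  set b := Module.finBasis ℝ A.range with hb
  have hX : ∀ i, ∃ X, A X = b i := fun i => (b i).2
  choose X hX using hX
  choose γ hγ using fun i => exists_isOneParameterSubgroup (K := K) (X i)
  set b' := Module.finBasis ℝ A.ker with hb'
  choose γ' hγ' using fun i => exists_isOneParameterSubgroup (K := K) (b' i : E)
  -- Lifts of a basis of the range of `A` together with a basis of its kernel span the Lie algebra.
  have hspan : Submodule.span ℝ (range X) ⊔ Submodule.span ℝ (range fun i => (b' i : E)) = ⊤ := by
    rw [eq_top_iff]
    intro Z _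
    set Y : E := ∑ i, b.repr ⟨A Z, Z, rfl⟩ i • X i with hY
    have hAY : A Y = A Z := by
      have h1 := congrArg (Subtype.val) (b.sum_repr ⟨A Z, Z, rfl⟩)
      simp only [AddSubmonoidClass.coe_finsetSum, Submodule.coe_smul] at h1
      rw [hY, map_sum]
      simp only [map_smul, hX]
      exact h1
    have h1 : Y ∈ Submodule.span ℝ (range X) := Submodule.sum_mem _ fun i _ =>
      Submodule.smul_mem _ _ (Submodule.subset_span ⟨i, rfl⟩)
    have h2 : Z - Y ∈ A.ker := by
      rw [LinearMap.mem_ker, map_sub, hAY, sub_self]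
    have h3 : Z - Y ∈ Submodule.span ℝ (range fun i => (b' i : E)) := by
      have h4 := congrArg (Submodule.map A.ker.subtype) b'.span_eq
      rw [Submodule.map_span, ← range_comp, Submodule.map_top, Submodule.range_subtype] at h4
      change Z - Y ∈ Submodule.span ℝ (range (A.ker.subtype ∘ b'))
      rwa [h4]
    exact Submodule.mem_sup.2 ⟨Y, h1, Z - Y, h3, add_sub_cancel _ _⟩
  set e : A.range →L[ℝ] (Fin (Module.finrank ℝ A.range) → ℝ) :=
    LinearMap.toContinuousLinearMap (b.equivFun : A.range →ₗ[ℝ] _) with he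
  set Ψ : A.range → K := fun x => orderedProd γ (e x) with hΨ
  have hΨs : ContMDiff 𝓘(ℝ, A.range) 𝓘(ℝ, E) ∞ Ψ :=
    (contMDiff_orderedProd hγ).comp e.contDiff.contMDiff
  set α : A.range → V := fun x => π (Ψ x) v with hα
  have hαs : ContDiff ℝ ∞ α := by
    have h1 : ContDiff ℝ ∞ fun x => π.toEnd (Ψ x) := (hπ.comp hΨs).contDiff
    exact ((ContinuousLinearMap.apply ℂ V v).restrictScalars ℝ).contDiff.comp h1
  have hαd : Differentiable ℝ α := hαs.differentiable (by simp)
  have hΨ0 : Ψ 0 = 1 := by simp [hΨ, orderedProd_zero hγ]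
  have hα0 : α 0 = v := by simp [hα, hΨ0]
  refine ⟨α, hα0, fun x => ⟨Ψ x, rfl⟩, hαs, ?_, ?_, ?_⟩
  · refine ContinuousLinearMap.coe_injective (b.ext fun i => ?_)
    have h1 : HasDerivAt (fun s : ℝ => s • b i) (b i) 0 := by
      simpa using (hasDerivAt_id (0 : ℝ)).smul_const (b i)
    have h2 := HasFDerivAt.comp_hasDerivAt_of_eq (0 : ℝ) (hαd 0).hasFDerivAt h1 (zero_smul _ _).symm
    have h3 : α ∘ (fun s : ℝ => s • b i) = fun s => π (γ i s) v := by
      ext s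
      have : e (s • b i) = Pi.single i s := by
        rw [he, LinearMap.coe_toContinuousLinearMap', LinearEquiv.coe_coe, map_smul]
        ext j
        rw [Pi.smul_apply, b.equivFun_apply, b.repr_self, Finsupp.single_apply, Pi.single_apply]
        simp [eq_comm]
      simp only [hα, hΨ, Function.comp, this, orderedProd_single hγ]
    rw [h3] at h2
    have h4 := h2.unique ((hγ i).hasDerivAt_apply hπd v)
    rw [← orbitDifferential_apply, ← hA, hX] at h4
    exact h4
  · intro x y
    -- Translation by `(Ψ x)⁻¹` moves the base point to `1`, where the matrix coefficient is
    -- stationary.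
    have hf : ContMDiff 𝓘(ℝ, A.range) 𝓘(ℝ, E) ∞ fun z => (Ψ x)⁻¹ * Ψ z :=
      contMDiff_const.mul hΨs
    have h1 := hasFDerivAt_inner_toEnd_comp hπd hμ (hf.mdifferentiable (by simp) x)
      (inv_mul_cancel _)
    have h2 : (fun z => inner ℂ v (π ((Ψ x)⁻¹ * Ψ z) v)) = fun z => inner ℂ (α x) (α z) := by
      ext z
      rw [← hK (Ψ x) v, ← Module.End.mul_apply, ← map_mul, mul_inv_cancel_left]
    rw [h2] at h1
    have h3 := ((innerSL ℂ (α x)).restrictScalars ℝ).hasFDerivAt.comp x (hαd x).hasFDerivAt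
    have h4 := h3.unique h1
    exact congrArg (fun L : A.range →L[ℝ] ℂ => L y) h4
  · intro δ hδ
    -- The factors coming from the kernel stand on the right, so they act on `v` first and fix it.
    -- Hence only the coordinate in the range matters.
    set N : Set K := (fun t : (Fin (Module.finrank ℝ A.range) → ℝ) ×
      (Fin (Module.finrank ℝ A.ker) → ℝ) => orderedProd γ t.1 * orderedProd γ' t.2) ''
        {t | ‖b.equivFun.symm t.1‖ ≤ δ} with hN
    have hN1 : N ∈ 𝓝 1 := by
      refine nhds_one_le_map_orderedProd_mul hγ hγ' hspan (image_mem_map ?_)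
      have hc : Continuous fun s => b.equivFun.symm s :=
        b.equivFun.symm.toLinearMap.continuous_of_finiteDimensional
      have hcont : Continuous fun t : (Fin (Module.finrank ℝ A.range) → ℝ) ×
          (Fin (Module.finrank ℝ A.ker) → ℝ) => ‖b.equivFun.symm t.1‖ :=
        (hc.comp continuous_fst).norm
      have := hcont.tendsto 0
      simp only [Prod.fst_zero, map_zero, norm_zero] at this
      filter_upwards [this.eventually_lt_const hδ] with t ht using ht.le
    let _ : MulAction K V := π.toMulAction
    have hcont : Continuous fun u : K => u • v :=
      (ContinuousLinearMap.apply ℂ V v).continuous.comp hπ.continuous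
    obtain ⟨r, hr, h⟩ := exists_dist_lt_imp_exists_smul_eq hcont hN1
    refine ⟨r, hr, fun u hu => ?_⟩
    obtain ⟨_, ⟨t, ht, rfl⟩, hu'⟩ := h u hu
    refine ⟨b.equivFun.symm t.1, ht, ?_⟩
    change π (orderedProd γ t.1 * orderedProd γ' t.2) v = π u v at hu'
    have hfix : π (orderedProd γ' t.2) v = v :=
      apply_orderedProd_eq_self (fun i s => (hγ' i).apply_eq_self hπd (b' i).2 s) _
    rw [← hu', map_mul, Module.End.mul_apply, hfix]
    change π (orderedProd γ (b.equivFun (b.equivFun.symm t.1))) v = _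
    rw [LinearEquiv.apply_symm_apply]

end OrbitParametrization
-- Second-order geometry of the orbit
section OrbitGeometry

open Set Metric

variable {V : Type*} [NormedAddCommGroup V] [InnerProductSpace ℂ V]

theorem exists_abs_dist_sub_dist_le {T : Submodule ℝ V} {α : T → V}
    (hα : HasStrictFDerivAt α T.subtypeL 0) {η : ℝ} (hη : 0 < η) :
    ∃ δ > 0, ∀ x ∈ closedBall (0 : T) δ, ∀ y ∈ closedBall (0 : T) δ,
      |dist (α x) (α y) - dist x y| ≤ η * dist x y := by
  have h1 := hα.isLittleO.def hη
  rw [nhds_prod_eq] at h1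
  obtain ⟨δ, hδ, h3⟩ := (nhds_basis_closedBall.prod_self).eventually_iff.1 h1
  refine ⟨δ, hδ, fun x hx y hy => ?_⟩
  have h4 := h3 (show (x, y) ∈ closedBall (0 : T) δ ×ˢ closedBall (0 : T) δ from ⟨hx, hy⟩)
  rw [dist_eq_norm, dist_eq_norm]
  have h5 : ‖x - y‖ = ‖T.subtypeL (x - y)‖ := rfl
  rw [h5]
  exact (abs_norm_sub_norm_le _ _).trans h4

/-- Along a manifold that is isotropic at `α 0` and everywhere orthogonal to its radius vector,
the imaginary part of the inner product with `α 0` vanishes to second order. -/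
theorem exists_abs_im_inner_le {T : Submodule ℝ V} {α : T → V} (hα : ContDiff ℝ 1 α)
    (hα0 : fderiv ℝ α 0 = T.subtypeL) (hαr : ∀ x y, inner ℂ (α x) (fderiv ℝ α x y) = 0)
    (hT : ∀ x y : T, (inner ℂ (x : V) (y : V)).im = 0) {ε : ℝ} (hε : 0 < ε) :
    ∃ δ > 0, ∀ x : T, ‖x‖ ≤ δ → |(inner ℂ (α 0) (α x)).im| ≤ ε * ‖α x - α 0‖ ^ 2 := by
  have hαd : Differentiable ℝ α := hα.differentiable (by simp)
  -- The mean value inequality will give `4 κ ‖x‖²`, and `κ ≤ 1 / 2` gives `‖x‖ ≤ 2 ‖α x - α 0‖`;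
  -- together they produce `16 κ`.
  obtain ⟨κ, hκ, hκ1, hκε⟩ : ∃ κ : ℝ, 0 < κ ∧ κ ≤ 1 / 2 ∧ 16 * κ ≤ ε :=
    ⟨min (1 / 2) (ε / 16), by positivity, min_le_left _ _, by
      linarith [min_le_right (1 / 2) (ε / 16)]⟩
  have h1 : ∀ᶠ x in 𝓝 (0 : T), ‖fderiv ℝ α x - T.subtypeL‖ ≤ κ := by
    have h : Tendsto (fun x => ‖fderiv ℝ α x - T.subtypeL‖) (𝓝 0) (𝓝 0) := by
      have h := ((hα.continuous_fderiv (by simp)).sub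
        (continuous_const (y := T.subtypeL))).norm.tendsto (0 : T)
      simpa only [Pi.sub_apply, hα0, sub_self, norm_zero] using h
    filter_upwards [h.eventually_lt_const hκ] with x hx using hx.le
  have h2 : ∀ᶠ x in 𝓝 (0 : T), ‖α x - α 0 - x‖ ≤ κ * ‖x‖ := by
    have h := (hαd 0).hasFDerivAt.isLittleO.def hκ
    rw [hα0] at h
    simpa using h
  obtain ⟨δ, hδ, hball⟩ := nhds_basis_closedBall.eventually_iff.1 (h1.and h2)
  have hderiv : ∀ x, HasFDerivAt (fun x => (inner ℂ (α 0) (α x)).im)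
      (Complex.imCLM.comp (((innerSL ℂ (α 0)).restrictScalars ℝ).comp (fderiv ℝ α x))) x :=
    fun x => Complex.imCLM.hasFDerivAt.comp x
      (((innerSL ℂ (α 0)).restrictScalars ℝ).hasFDerivAt.comp x (hαd x).hasFDerivAt)
  have him : ∀ (a b : V), |(inner ℂ a b).im| ≤ ‖a‖ * ‖b‖ := fun a b =>
    (Complex.abs_im_le_norm _).trans (norm_inner_le_norm _ _)
  have hbound : ∀ R ≤ δ, ∀ x ∈ closedBall (0 : T) R,
      ‖Complex.imCLM.comp (((innerSL ℂ (α 0)).restrictScalars ℝ).comp (fderiv ℝ α x))‖ ≤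
        4 * κ * R := by
    intro R hR x hx
    have hxR : ‖x‖ ≤ R := by simpa using hx
    obtain ⟨hx1, hx2⟩ := hball (closedBall_subset_closedBall hR hx)
    have hR0 : 0 ≤ R := (norm_nonneg _).trans hxR
    refine ContinuousLinearMap.opNorm_le_bound _ (by positivity) fun y => ?_
    change |(inner ℂ (α 0) (fderiv ℝ α x y)).im| ≤ _
    -- Write `α 0 = α x - (α x - α 0 - x) - x`. The term with `α x` vanishes by radial
    -- orthogonality, and isotropy allows the tangent part of the derivative to be removed from the
    -- term with `x`. Both remaining terms are of size `κ ‖x‖ ‖y‖`.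
    have e1 : (inner ℂ (α 0) (fderiv ℝ α x y)).im =
        -(inner ℂ (α x - α 0 - x) (fderiv ℝ α x y)).im -
          (inner ℂ (x : V) ((fderiv ℝ α x - T.subtypeL) y)).im := by
      have e2 : (inner ℂ (x : V) ((fderiv ℝ α x - T.subtypeL) y)).im =
          (inner ℂ (x : V) (fderiv ℝ α x y)).im := by
        have h := hT x y
        rw [sub_apply, inner_sub_right, Complex.sub_im]
        simpa using h
      rw [e2, inner_sub_left, inner_sub_left, hαr]
      simp
    have e3 : ‖fderiv ℝ α x y‖ ≤ 2 * ‖y‖ := by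
      have h3 : fderiv ℝ α x y = (fderiv ℝ α x - T.subtypeL) y + y := by simp
      have h4 := ((fderiv ℝ α x - T.subtypeL).le_opNorm y).trans
        (mul_le_mul_of_nonneg_right hx1 (norm_nonneg y))
      rw [h3]
      refine (norm_add_le _ _).trans ?_
      have h5 : ‖(y : V)‖ = ‖y‖ := rfl
      have := mul_le_mul_of_nonneg_right hκ1 (norm_nonneg y)
      linarith [norm_nonneg y]
    have e4 := him (α x - α 0 - x) (fderiv ℝ α x y)
    have e5 := him (x : V) ((fderiv ℝ α x - T.subtypeL) y)
    have e6 : ‖α x - α 0 - x‖ * ‖fderiv ℝ α x y‖ ≤ (κ * R) * (2 * ‖y‖) := by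
      gcongr
      exact hx2.trans (by gcongr)
    have e7 : ‖(x : V)‖ * ‖(fderiv ℝ α x - T.subtypeL) y‖ ≤ R * (κ * ‖y‖) := by
      gcongr
      · exact hxR
      · exact ((fderiv ℝ α x - T.subtypeL).le_opNorm y).trans
          (mul_le_mul_of_nonneg_right hx1 (norm_nonneg y))
    rw [e1]
    refine (abs_sub _ _).trans ?_
    rw [abs_neg]
    have : 0 ≤ κ * R * ‖y‖ := by positivity
    linarith
  refine ⟨δ, hδ, fun x hx => ?_⟩
  have hmvt := (convex_closedBall (0 : T) ‖x‖).norm_image_sub_le_of_norm_hasFDerivWithin_le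
    (fun z _ => (hderiv z).hasFDerivWithinAt) (hbound ‖x‖ hx)
    (mem_closedBall_self (norm_nonneg x)) (show x ∈ closedBall (0 : T) ‖x‖ by simp)
  have h0 : (inner ℂ (α 0) (α 0)).im = 0 := inner_self_im (𝕜 := ℂ) (α 0)
  rw [h0, sub_zero, sub_zero, Real.norm_eq_abs] at hmvt
  have hx2 := (hball (show x ∈ closedBall (0 : T) δ by simpa using hx)).2
  have hlow : ‖x‖ / 2 ≤ ‖α x - α 0‖ := by
    have h3 : ‖(x : V)‖ = ‖x‖ := rfl
    have h4 := norm_sub_norm_le (x : V) (x - (α x - α 0))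
    rw [sub_sub_cancel, ← norm_neg ((x : V) - (α x - α 0)), neg_sub] at h4
    have := mul_le_mul_of_nonneg_right hκ1 (norm_nonneg x)
    linarith
  calc |(inner ℂ (α 0) (α x)).im| ≤ 4 * κ * ‖x‖ * ‖x‖ := hmvt
    _ = 16 * κ * (‖x‖ / 2) ^ 2 := by ring
    _ ≤ ε * ‖α x - α 0‖ ^ 2 := by gcongr

end OrbitGeometry

/-! ### The matrix coefficient `⟪v, π u v⟫` and its peaks -/

section MatrixCoefficient

open Set MeasureTheory

section StabilizerDimension

variable {E : Type*} [NormedAddCommGroup E] [NormedSpace ℝ E] [FiniteDimensional ℝ E]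
  {K : Type*} [TopologicalSpace K] [ChartedSpace E K] [Group K] [LieGroup 𝓘(ℝ, E) ∞ K] [T2Space K]
  {V : Type*} [NormedAddCommGroup V] [InnerProductSpace ℂ V] [FiniteDimensional ℂ V]
  {π : Representation ℂ K V}

/-- When the moment map vanishes at the unit vector `v`, the Lie algebra of the stabilizer
of the line `ℂ v` is the annihilator of `v`. -/
theorem lieDim_lineStabilizer (hπ : MDifferentiable 𝓘(ℝ, E) 𝓘(ℝ, V →L[ℂ] V) π.toEnd) {v : V}
    (hv : ‖v‖ = 1) (hμ : ∀ X, inner ℂ v (π.realInfinitesimal E X v) = 0) :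
    Subgroup.lieDim E (π.lineStabilizer v) =
      Module.finrank ℝ (π.orbitDifferential E v).ker := by
  have hcompl : CompleteSpace E := FiniteDimensional.complete ℝ E
  have hset : {X : E | ∃ γ : ℝ → K, (∀ s t, γ (s + t) = γ s * γ t) ∧
      ContMDiff 𝓘(ℝ, ℝ) 𝓘(ℝ, E) ∞ γ ∧ (∀ t, γ t ∈ π.lineStabilizer v) ∧
      X = (mfderiv 𝓘(ℝ, ℝ) 𝓘(ℝ, E) γ 0 (1 : ℝ) : E)} =
      ((π.orbitDifferential E v).ker : Set E) := by
    ext X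
    constructor
    · rintro ⟨γ, hadd, hs, hmem, hX⟩
      have hγ : IsOneParameterSubgroup E γ X := ⟨hadd, hs, hX⟩
      -- A curve in the stabilizer of the line moves `v` only by the scalar `⟪v, π (γ t) v⟫`, whose
      -- derivative at `0` vanishes by `hμ`.
      have hline : (fun t => π (γ t) v) = fun t => inner ℂ v (π (γ t) v) • v := by
        ext t
        have h1 : π (γ t) v ∈ Submodule.span ℂ {v} := by
          have h2 : (Submodule.span ℂ {v}).map (π (γ t)) = Submodule.span ℂ {v} := hmem t
          rw [← h2]
          exact Submodule.mem_map_of_mem (Submodule.mem_span_singleton_self v)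
        obtain ⟨c, hc⟩ := Submodule.mem_span_singleton.1 h1
        rw [← hc, inner_smul_right, inner_self_eq_norm_sq_to_K, hv]
        simp
      have h1 := hγ.hasDerivAt_apply hπ v
      have h2 : HasDerivAt (fun t => inner ℂ v (π (γ t) v)) (0 : ℂ) 0 := by
        have := ((innerSL ℂ v).restrictScalars ℝ).hasFDerivAt.comp_hasDerivAt (0 : ℝ) h1
        rw [← hμ X]
        exact this
      have h3 := h2.smul_const v
      rw [hline, zero_smul] at *
      exact h1.unique h3
    · intro hX
      obtain ⟨γ, hγ⟩ := exists_isOneParameterSubgroup (K := K) X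
      refine ⟨γ, hγ.add, hγ.contMDiff, fun t => ?_, hγ.mfderiv_eq⟩
      change (Submodule.span ℂ {v}).map (π (γ t)) = Submodule.span ℂ {v}
      rw [Submodule.map_span, image_singleton, hγ.apply_eq_self hπ hX]
  change Module.finrank ℝ (Submodule.span ℝ {X : E | ∃ γ : ℝ → K,
      (∀ s t, γ (s + t) = γ s * γ t) ∧
      ContMDiff 𝓘(ℝ, ℝ) 𝓘(ℝ, E) ∞ γ ∧ (∀ t, γ t ∈ π.lineStabilizer v) ∧
      X = (mfderiv 𝓘(ℝ, ℝ) 𝓘(ℝ, E) γ 0 (1 : ℝ) : E)}) = _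
  rw [hset, Submodule.span_eq]

end StabilizerDimension

/-- Each ball of a finite cover by balls of radius `δ / 2` contains at most one point of `D`. -/
theorem Set.finite_of_isCompact_of_forall_dist {X : Type*} [MetricSpace X] {C D : Set X}
    (hC : IsCompact C) (hDC : D ⊆ C) {δ : ℝ} (hδ : 0 < δ)
    (hD : ∀ x ∈ D, ∀ y ∈ D, dist x y ≤ δ → x = y) : D.Finite := by
  obtain ⟨t, -, ht, hcov⟩ := hC.finite_cover_balls (half_pos hδ)
  have h1 : D ⊆ ⋃ x ∈ t, (D ∩ Metric.ball x (δ / 2)) := by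
    intro w hw
    obtain ⟨x, hx, hwx⟩ := mem_iUnion₂.1 (hcov (hDC hw))
    exact mem_iUnion₂.2 ⟨x, hx, hw, hwx⟩
  refine (ht.biUnion fun x _ => Set.Subsingleton.finite fun a ha b hb => ?_).subset h1
  refine hD a ha.1 b hb.1 ?_
  have := dist_triangle_right a b x
  linarith [Metric.mem_ball.1 ha.2, Metric.mem_ball.1 hb.2]

section LaplaceOrbit

variable {K : Type*} [Group K]
  {V : Type*} [NormedAddCommGroup V] [InnerProductSpace ℂ V]
  {π : Representation ℂ K V}

/-- The group of scalars by which elements of `K` act on the line through `v`. -/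
def lineCharacterImage (π : Representation ℂ K V) (v : V) : Subgroup ℂˣ where
  carrier := {ζ | ∃ u, π u v = (ζ : ℂ) • v}
  one_mem' := ⟨1, by simp⟩
  mul_mem' := by
    rintro a b ⟨s, hs⟩ ⟨t, ht⟩
    exact ⟨s * t, by rw [map_mul, Module.End.mul_apply, ht, map_smul, hs, smul_smul,
      Units.val_mul, mul_comm]⟩
  inv_mem' := by
    rintro a ⟨s, hs⟩
    refine ⟨s⁻¹, ?_⟩
    have h : π s⁻¹ (π s v) = v := by
      rw [← Module.End.mul_apply, ← map_mul, inv_mul_cancel, map_one, Module.End.one_apply]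
    rw [hs, map_smul] at h
    conv_rhs => rw [← h]
    rw [smul_smul, Units.inv_mul, one_smul]

variable (hK : ∀ (u : K) (x y : V), inner ℂ (π u x) (π u y) = inner ℂ x y)

include hK

theorem norm_apply_of_inner (u : K) (x : V) : ‖π u x‖ = ‖x‖ := by
  have h := hK u x x
  rw [inner_self_eq_norm_sq_to_K, inner_self_eq_norm_sq_to_K] at h
  have h' : ‖π u x‖ ^ 2 = ‖x‖ ^ 2 := by exact_mod_cast h
  exact (pow_left_inj₀ (norm_nonneg _) (norm_nonneg _) two_ne_zero).1 h'

theorem dist_apply_apply (u : K) (x y : V) : dist (π u x) (π u y) = dist x y := by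
  rw [dist_eq_norm, dist_eq_norm, ← map_sub, norm_apply_of_inner hK]

theorem dist_inv_mul_apply (s u : K) (x : V) :
    dist (π (s⁻¹ * u) x) x = dist (π u x) (π s x) := by
  rw [← dist_apply_apply hK s, ← Module.End.mul_apply, ← map_mul, mul_inv_cancel_left]

variable {v : V} (hv : ‖v‖ = 1)

include hv

/-- For unit vectors `‖v - π u v‖² = 2 - 2 Re ⟪v, π u v⟫`, so only the imaginary part needs the
moment map. -/
theorem inner_apply_eq_one_sub (u : K) :
    inner ℂ v (π u v) = (1 - dist (π u v) v ^ 2 / 2 : ℝ) +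
      ((inner ℂ v (π u v)).im : ℝ) * Complex.I := by
  have h := norm_sub_sq (𝕜 := ℂ) v (π u v)
  rw [norm_apply_of_inner hK, hv] at h
  rw [dist_comm, dist_eq_norm, h]
  apply Complex.ext
  · simp
    ring
  · simp

theorem norm_inner_apply_le (u : K) : ‖inner ℂ v (π u v)‖ ≤ 1 := by
  have := norm_inner_le_norm (𝕜 := ℂ) v (π u v)
  rwa [norm_apply_of_inner hK, hv, one_mul] at this

/-- The equality case of Cauchy–Schwarz, which locates the peaks on the stabilizer of the line. -/
theorem apply_eq_smul_of_norm_inner_eq_one {u : K} (h : ‖inner ℂ v (π u v)‖ = 1) :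
    π u v = inner ℂ v (π u v) • v := by
  have h1 : inner ℂ (π u v) (inner ℂ v (π u v) • v) = 1 := by
    rw [inner_smul_right, ← inner_conj_symm (π u v) v, RCLike.mul_conj, h]
    simp
  rw [← sub_eq_zero, ← norm_eq_zero, ← sq_eq_zero_iff, norm_sub_sq (𝕜 := ℂ), h1,
    norm_apply_of_inner hK, norm_smul, hv, h]
  norm_num

/-- Translating by an element that scales `v`. -/
theorem inner_apply_eq_mul_of_apply_eq_smul {s : K} {ζ : ℂˣ} (hs : π s v = (ζ : ℂ) • v) (u : K) :
    inner ℂ v (π u v) = ζ * inner ℂ v (π (s⁻¹ * u) v) := by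
  have hζ : ‖(ζ : ℂ)‖ = 1 := by
    have := norm_apply_of_inner hK s v
    rwa [hs, norm_smul, hv, mul_one] at this
  rw [← hK s v (π (s⁻¹ * u) v), ← Module.End.mul_apply, ← map_mul, mul_inv_cancel_left, hs,
    inner_smul_left, ← mul_assoc, RCLike.mul_conj, hζ]
  simp

variable (him : ∀ ε > 0, ∃ δ > 0, ∀ u : K, dist (π u v) v ≤ δ →
  |(inner ℂ v (π u v)).im| ≤ ε * dist (π u v) v ^ 2)

include him

theorem exists_norm_inner_sub_le {ε : ℝ} (hε : 0 < ε) : ∃ δ > 0, ∀ u : K, dist (π u v) v ≤ δ →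
    ‖inner ℂ v (π u v) - (1 - dist (π u v) v ^ 2 / 2 : ℝ)‖ ≤ ε * dist (π u v) v ^ 2 := by
  obtain ⟨δ, hδ, h⟩ := him ε hε
  refine ⟨δ, hδ, fun u hu => ?_⟩
  have := inner_apply_eq_one_sub hK hv u
  rw [← sub_eq_iff_eq_add'] at this
  rw [this, norm_mul, Complex.norm_I, mul_one, Complex.norm_real]
  exact h u hu

/-- For `π u v = ζ v` one has `ρ = |ζ - 1|`, while the expansion of the coefficient gives `|ζ - 1| ≤
ρ²`. For `ρ ≤ 1 / 2` this forces `ρ = 0`, so the scalars are discrete. -/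
theorem exists_apply_eq_self_of_dist_le : ∃ δ > 0, ∀ u : K, dist (π u v) v ≤ δ →
    ∀ ζ : ℂ, π u v = ζ • v → π u v = v := by
  obtain ⟨δ, hδ, h⟩ := exists_norm_inner_sub_le hK hv him (ε := 1 / 2) (by norm_num)
  refine ⟨min δ (1 / 2), by positivity, fun u hu ζ hζ => ?_⟩
  have h1 := h u (hu.trans (min_le_left _ _))
  have h2 : dist (π u v) v = ‖ζ - 1‖ := by
    rw [hζ, dist_eq_norm]
    nth_rewrite 2 [← one_smul ℂ v]
    rw [← sub_smul, norm_smul, hv, mul_one]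
  have h3 : inner ℂ v (π u v) = ζ := by
    rw [hζ, inner_smul_right, inner_self_eq_norm_sq_to_K, hv]
    simp
  set ρ := dist (π u v) v with hρ
  have hρ1 : ρ ≤ 1 / 2 := hu.trans (min_le_right _ _)
  rw [h3] at h1
  have h4 : ‖ζ - 1‖ ≤ ‖ζ - (1 - ρ ^ 2 / 2 : ℝ)‖ + ‖((1 - ρ ^ 2 / 2 : ℝ) : ℂ) - 1‖ :=
    norm_sub_le_norm_sub_add_norm_sub _ _ _
  have h5 : ‖((1 - ρ ^ 2 / 2 : ℝ) : ℂ) - 1‖ = ρ ^ 2 / 2 := by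
    rw [← Complex.ofReal_one, ← Complex.ofReal_sub, Complex.norm_real, Real.norm_eq_abs, abs_sub_comm,
      sub_sub_cancel, abs_of_nonneg (by positivity)]
  rw [← h2, h5] at h4
  have hρ0 : 0 ≤ ρ := dist_nonneg
  refine dist_le_zero.1 ?_
  nlinarith

theorem exists_norm_inner_pow_sub_le (m : ℕ) {ε : ℝ} (hε : 0 < ε) :
    ∃ δ > 0, ∀ u : K, dist (π u v) v ≤ δ →
      ‖inner ℂ v (π u v) ^ m - (1 - m / 2 * dist (π u v) v ^ 2 : ℝ)‖ ≤
        ε * dist (π u v) v ^ 2 := by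
  have hd : HasDerivAt (fun z : ℂ => z ^ m) m 1 := by
    simpa using hasDerivAt_pow m (1 : ℂ)
  have h1 := (hasDerivAt_iff_isLittleO.1 hd).def (half_pos hε)
  obtain ⟨η, hη, hball⟩ := Metric.eventually_nhds_iff_ball.1 h1
  -- The bound `1 / 2` yields `‖z - 1‖ ≤ ρ²`, which controls the error of linearizing `z ^ m`; the
  -- other yields `m κ ≤ ε / 2`.
  set κ : ℝ := min (1 / 2) (ε / (2 * (m + 1))) with hκ
  have hκ0 : 0 < κ := by positivity
  obtain ⟨δ, hδ, h⟩ := exists_norm_inner_sub_le hK hv him hκ0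
  refine ⟨min δ (min 1 (η / 2)), by positivity, fun u hu => ?_⟩
  have h2 := h u (hu.trans (min_le_left _ _))
  set ρ := dist (π u v) v with hρ
  set z : ℂ := inner ℂ v (π u v) with hz
  have hρ0 : 0 ≤ ρ := dist_nonneg
  have hρ1 : ρ ≤ 1 := hu.trans ((min_le_right _ _).trans (min_le_left _ _))
  have hρη : ρ ≤ η / 2 := hu.trans ((min_le_right _ _).trans (min_le_right _ _))
  have h5 : ‖((1 - ρ ^ 2 / 2 : ℝ) : ℂ) - 1‖ = ρ ^ 2 / 2 := by
    rw [← Complex.ofReal_one, ← Complex.ofReal_sub, Complex.norm_real, Real.norm_eq_abs, abs_sub_comm,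
      sub_sub_cancel, abs_of_nonneg (by positivity)]
  have h6 : ‖z - 1‖ ≤ ρ ^ 2 := by
    have h4 : ‖z - 1‖ ≤ ‖z - (1 - ρ ^ 2 / 2 : ℝ)‖ + ‖((1 - ρ ^ 2 / 2 : ℝ) : ℂ) - 1‖ :=
      norm_sub_le_norm_sub_add_norm_sub _ _ _
    have := mul_le_mul_of_nonneg_right (min_le_left (1 / 2) (ε / (2 * (m + 1)))) (sq_nonneg ρ)
    rw [h5] at h4
    linarith
  have h7 : ‖z ^ m - 1 - (z - 1) * m‖ ≤ ε / 2 * ρ ^ 2 := by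
    have hzη : z ∈ Metric.ball (1 : ℂ) η := by
      rw [Metric.mem_ball, dist_eq_norm]
      nlinarith
    have := hball z hzη
    simp only [one_pow, smul_eq_mul] at this
    exact this.trans (by gcongr)
  have h8 : z ^ m - (1 - m / 2 * ρ ^ 2 : ℝ) =
      (z ^ m - 1 - (z - 1) * m) + m * (z - (1 - ρ ^ 2 / 2 : ℝ)) := by
    push_cast
    ring
  have h9 : m * κ ≤ ε / 2 := by
    calc m * κ ≤ m * (ε / (2 * (m + 1))) := by
          gcongr
          exact min_le_right _ _
      _ ≤ ε / 2 := by
          rw [mul_div_assoc', div_le_div_iff₀ (by positivity) (by norm_num)]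
          nlinarith
  calc ‖z ^ m - (1 - m / 2 * ρ ^ 2 : ℝ)‖
      ≤ ε / 2 * ρ ^ 2 + m * (κ * ρ ^ 2) := by
        rw [h8]
        refine (norm_add_le _ _).trans ?_
        rw [norm_mul, Complex.norm_natCast]
        gcongr
    _ = ε / 2 * ρ ^ 2 + m * κ * ρ ^ 2 := by ring
    _ ≤ ε / 2 * ρ ^ 2 + ε / 2 * ρ ^ 2 := by gcongr
    _ = ε * ρ ^ 2 := by ring

variable [TopologicalSpace K] [IsTopologicalGroup K] [CompactSpace K] [MeasurableSpace K]
  [BorelSpace K]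

/-- Powers of a matrix coefficient decay at the rate given by the volume of small balls. -/
theorem exists_tendsto_integral_inner_pow (P : Measure K) [IsProbabilityMeasure P]
    [P.IsMulLeftInvariant] (hcont : Continuous fun u : K => π u v) {d : ℕ} {c : ℝ} (hc : 0 < c)
    (hF : Tendsto (fun r => P.real {u : K | dist (π u v) v ≤ r} / r ^ d) (𝓝[>] 0) (𝓝 c)) :
    ∃ m : ℕ, 0 < m ∧ ∃ L : ℝ, 0 < L ∧ Tendsto (fun k : ℕ => (((k : ℝ) ^ ((d : ℝ) / 2) : ℝ) : ℂ) *
      ∫ u, (inner ℂ v (π u v)) ^ (m * k) ∂P) atTop (𝓝 (L : ℂ)) := by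
  have hv0 : v ≠ 0 := by
    rintro rfl
    simp at hv
  obtain ⟨δ₁, hδ₁, hsep⟩ := exists_apply_eq_self_of_dist_le hK hv him
  set Z := lineCharacterImage π v with hZ
  -- The points where the orbit meets the line `ℂ v`, that is, the images of the peaks. They are
  -- separated by `δ₁` and lie in a compact set, hence are finite in number.
  set D : Set V := (fun ζ : ℂˣ => (ζ : ℂ) • v) '' Z with hD
  have hDrange : ∀ w ∈ D, ∃ s, π s v = w := by
    rintro _ ⟨ζ, ⟨s, hs⟩, rfl⟩
    exact ⟨s, hs⟩
  have hDsep : ∀ x ∈ D, ∀ y ∈ D, dist x y ≤ δ₁ → x = y := by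
    rintro _ ⟨ζ, hζ, rfl⟩ _ ⟨ξ, hξ, rfl⟩ hxy
    obtain ⟨s, hs⟩ := hζ
    obtain ⟨t, ht⟩ := hξ
    simp only [← hs, ← ht] at hxy ⊢
    have h1 : π (t⁻¹ * s) v = ((ξ⁻¹ * ζ : ℂˣ) : ℂ) • v := by
      have hinv : π t⁻¹ v = ((ξ⁻¹ : ℂˣ) : ℂ) • v := by
        have h : π t⁻¹ (π t v) = v := by
          rw [← Module.End.mul_apply, ← map_mul, inv_mul_cancel, map_one, Module.End.one_apply]
        rw [ht, map_smul] at h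
        conv_rhs => rw [← h]
        rw [smul_smul, Units.inv_mul, one_smul]
      rw [map_mul, Module.End.mul_apply, hs, map_smul, hinv, smul_smul, Units.val_mul, mul_comm]
    rw [← dist_inv_mul_apply hK] at hxy
    have h2 := hsep _ hxy _ h1
    have h3 := dist_inv_mul_apply hK t s v
    rw [h2, dist_self] at h3
    exact dist_eq_zero.1 h3.symm
  have hDfin : D.Finite := by
    refine Set.finite_of_isCompact_of_forall_dist (isCompact_range hcont) (fun w hw => ?_) hδ₁ hDsep
    obtain ⟨s, hs⟩ := hDrange w hw
    exact ⟨s, hs⟩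
  have hvD : v ∈ D := ⟨1, Z.one_mem, by simp⟩
  have hZfin : Finite Z := by
    refine Set.Finite.of_finite_image hDfin ?_
    intro a _ b _ hab
    exact Units.ext (smul_left_injective ℂ hv0 hab)
  -- The `m`-th power kills every scalar in the finite group `Z`, so all peaks of the coefficient
  -- acquire the value `1`.
  set m : ℕ := Nat.card Z with hm
  have hm0 : 0 < m := Nat.card_pos
  have hroot : ∀ ζ ∈ Z, (ζ : ℂ) ^ m = 1 := by
    intro ζ hζ
    have h1 : (⟨ζ, hζ⟩ : Z) ^ m = 1 := pow_card_eq_one'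
    have h2 : ζ ^ m = 1 := congrArg Subtype.val h1
    rw [← Units.val_pow_eq_pow_val, h2, Units.val_one]
  set ρ : K → ℝ := fun u => Metric.infDist (π u v) D with hρ
  have hρcont : Continuous ρ := (Metric.continuous_infDist_pt D).comp hcont
  have hnear : ∀ u, ∃ s, ∃ ζ : ℂˣ, π s v = (ζ : ℂ) • v ∧ ρ u = dist (π (s⁻¹ * u) v) v := by
    intro u
    obtain ⟨w, ⟨ζ, ⟨s, hs⟩, rfl⟩, hw⟩ := hDfin.isCompact.exists_infDist_eq_dist ⟨v, hvD⟩ (π u v)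
    refine ⟨s, ζ, hs, ?_⟩
    rw [dist_inv_mul_apply hK, hs]
    exact hw
  have hpow : ∀ (s : K) (ζ : ℂˣ), π s v = (ζ : ℂ) • v → ∀ u,
      inner ℂ v (π u v) ^ m = inner ℂ v (π (s⁻¹ * u) v) ^ m := by
    intro s ζ hs u
    rw [inner_apply_eq_mul_of_apply_eq_smul hK hv hs, mul_pow, hroot ζ ⟨s, hs⟩, one_mul]
  have hfcont : Continuous fun u => inner ℂ v (π u v) := continuous_const.inner hcont
  have hballs : ∀ w ∈ D, ∀ r, P.real {u | dist (π u v) w ≤ r} =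
      P.real {u | dist (π u v) v ≤ r} := by
    intro w hw r
    obtain ⟨s, rfl⟩ := hDrange w hw
    rw [measureReal_def, measureReal_def, ← measure_preimage_mul P s⁻¹ {u | dist (π u v) v ≤ r}]
    congr 2
    ext u
    simp only [mem_ofPred_eq, mem_preimage, dist_inv_mul_apply hK]
  -- Below half the separation, the set is a disjoint union of translates of one ball, one for each
  -- point of `D`.
  have hvol : ∀ r, r < δ₁ / 2 → P.real {u | ρ u ≤ r} =
      D.ncard * P.real {u | dist (π u v) v ≤ r} := by
    intro r hr
    have hU : {u | ρ u ≤ r} = ⋃ w ∈ hDfin.toFinset, {u | dist (π u v) w ≤ r} := by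
      ext u
      simp only [mem_ofPred_eq, mem_iUnion, Finite.mem_toFinset, exists_prop]
      constructor
      · intro hu
        obtain ⟨w, hw, hdist⟩ := hDfin.isCompact.exists_infDist_eq_dist ⟨v, hvD⟩ (π u v)
        exact ⟨w, hw, hdist.symm.trans_le hu⟩
      · rintro ⟨w, hw, hdist⟩
        exact (Metric.infDist_le_dist_of_mem hw).trans hdist
    rw [hU, measureReal_biUnion_finset]
    · rw [Finset.sum_congr rfl fun w hw => hballs w (hDfin.mem_toFinset.1 hw) r,
        Finset.sum_const, nsmul_eq_mul, ncard_eq_toFinset_card D hDfin]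
    · intro a ha b hb hab
      refine disjoint_left.2 fun u hua hub => hab ?_
      refine hDsep a (hDfin.mem_toFinset.1 ha) b (hDfin.mem_toFinset.1 hb) ?_
      have h1 : dist (π u v) a ≤ r := hua
      have h2 : dist (π u v) b ≤ r := hub
      have := dist_triangle_left a b (π u v)
      linarith
    · intro w _
      exact measurableSet_le (hcont.dist continuous_const).measurable measurable_const
  have hF' : Tendsto (fun r => P.real {u | ρ u ≤ r} / r ^ d) (𝓝[>] 0) (𝓝 (D.ncard * c)) := by
    refine (hF.const_mul (D.ncard : ℝ)).congr' ?_
    have : ∀ᶠ r : ℝ in 𝓝[>] 0, r < δ₁ / 2 :=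
      (eventually_lt_nhds (half_pos hδ₁)).filter_mono nhdsWithin_le_nhds
    filter_upwards [this] with r hr
    rw [hvol r hr, mul_div_assoc]
  have hDcard : 0 < D.ncard := (ncard_pos hDfin).2 ⟨v, hvD⟩
  have hlim := tendsto_rpow_mul_integral_pow (P := P) hρcont.measurable
    (fun _ => Metric.infDist_nonneg) hF' (h := fun u => inner ℂ v (π u v) ^ m)
    (hfcont.pow m).measurable (fun u => by
      rw [norm_pow]
      exact pow_le_one₀ (norm_nonneg _) (norm_inner_apply_le hK hv u))
    (a := (m : ℝ) / 2) (by positivity) (fun ε hε => by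
      obtain ⟨δ, hδ, h⟩ := exists_norm_inner_pow_sub_le hK hv him m hε
      refine ⟨δ, hδ, fun u hu => ?_⟩
      obtain ⟨s, ζ, hs, hd⟩ := hnear u
      rw [hpow s ζ hs, hd]
      exact h _ (hd ▸ hu.le)) (fun δ hδ => by
      -- Away from `D` the coefficient has norm strictly below `1`; compactness makes the gap
      -- uniform.
      have hcpt : IsCompact {u | δ ≤ ρ u} := (isClosed_le continuous_const hρcont).isCompact
      obtain ⟨q, hq, h⟩ := hcpt.exists_forall_le' (f := fun u => 1 - ‖inner ℂ v (π u v)‖) (a := 0)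
        (continuous_const.sub hfcont.norm).continuousOn (fun u hu => by
          refine sub_pos.2 (lt_of_le_of_ne (norm_inner_apply_le hK hv u) fun h1 => ?_)
          have h2 := apply_eq_smul_of_norm_inner_eq_one hK hv h1
          have h3 : inner ℂ v (π u v) ≠ 0 := by
            intro h0
            rw [h0, norm_zero] at h1
            exact zero_ne_one h1
          have h4 : π u v ∈ D := ⟨Units.mk0 _ h3, ⟨u, h2⟩, h2.symm⟩
          have h5 : ρ u = 0 := Metric.infDist_zero_of_mem h4
          have hu : δ ≤ ρ u := hu
          linarith)
      refine ⟨1 - q, by linarith, fun u hu => ?_⟩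
      rw [norm_pow]
      refine (pow_le_of_le_one (norm_nonneg _) (norm_inner_apply_le hK hv u) hm0.ne').trans ?_
      have : q ≤ 1 - ‖inner ℂ v (π u v)‖ := h u hu
      linarith)
  simp only [← pow_mul] at hlim
  refine ⟨m, hm0, _, ?_, hlim⟩
  have := Real.Gamma_pos_of_pos (show 0 < (d : ℝ) / 2 + 1 by positivity)
  positivity

end LaplaceOrbit

end MatrixCoefficient

/-! ### Complex manifolds and maps regarded as real ones -/

section RestrictScalars

variable {F : Type*} [NormedAddCommGroup F] [NormedSpace ℂ F]
  {M : Type*} [TopologicalSpace M] [ChartedSpace F M]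
  {F' : Type*} [NormedAddCommGroup F'] [NormedSpace ℂ F']
  {N : Type*} [TopologicalSpace N] [ChartedSpace F' N] {f : M → N}

theorem ContMDiff.restrictScalars_real {n : ℕ∞ω} (hf : ContMDiff 𝓘(ℂ, F) 𝓘(ℂ, F') n f) :
    ContMDiff 𝓘(ℝ, F) 𝓘(ℝ, F') n f := by
  intro x
  have h := contMDiffAt_iff.1 (hf x)
  exact contMDiffAt_iff.2 ⟨h.1, h.2.restrict_scalars ℝ⟩

theorem HasMFDerivAt.restrictScalars_real {x : M} {f' : F →L[ℂ] F'}
    (hf : HasMFDerivAt 𝓘(ℂ, F) 𝓘(ℂ, F') f x f') :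
    HasMFDerivAt 𝓘(ℝ, F) 𝓘(ℝ, F') f x (f'.restrictScalars ℝ) :=
  ⟨hf.1, HasFDerivWithinAt.restrictScalars ℝ hf.2⟩

end RestrictScalars

/-! ### The unitarian trick: invariants of `K` and of `G` -/

section HolomorphicCoefficients

universe w

variable {F : Type*} [NormedAddCommGroup F] [NormedSpace ℂ F]
  {M : Type*} [TopologicalSpace M] [ChartedSpace F M]

theorem contMDiff_of_forall_linear {X : Type*} [NormedAddCommGroup X] [NormedSpace ℂ X]
    [FiniteDimensional ℂ X] {n : ℕ∞ω} {f : M → X}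
    (h : ∀ l : X →ₗ[ℂ] ℂ, ContMDiff 𝓘(ℂ, F) 𝓘(ℂ, ℂ) n fun x => l (f x)) :
    ContMDiff 𝓘(ℂ, F) 𝓘(ℂ, X) n f := by
  set b := Module.finBasis ℂ X
  have hf : f = fun x => ∑ i, b.coord i (f x) • b i := by
    ext x
    exact (b.sum_repr (f x)).symm
  rw [hf]
  have hg : ContDiff ℂ n fun c : Fin (Module.finrank ℂ X) → ℂ => ∑ i, c i • b i := by
    refine ContDiff.sum fun i _ => ?_
    exact (contDiff_apply ℂ ℂ i).smul contDiff_const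
  exact hg.contMDiff.comp (contMDiff_pi_space.2 fun i => h (b.coord i))

theorem contMDiff_linear_of_forall_coeff {U : Type*} [AddCommGroup U] [Module ℂ U]
    [FiniteDimensional ℂ U] {n : ℕ∞ω} {A : M → Module.End ℂ U}
    (h : ∀ (l : U →ₗ[ℂ] ℂ) (x : U), ContMDiff 𝓘(ℂ, F) 𝓘(ℂ, ℂ) n fun g => l (A g x))
    (L : Module.End ℂ U →ₗ[ℂ] ℂ) : ContMDiff 𝓘(ℂ, F) 𝓘(ℂ, ℂ) n fun g => L (A g) := by
  set b := Module.finBasis ℂ U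
  have hb (T : Module.End ℂ U) :
      T = ∑ p : Fin (Module.finrank ℂ U) × Fin (Module.finrank ℂ U),
        b.coord p.1 (T (b p.2)) • (b.coord p.2).smulRight (b p.1) := by
    refine b.ext fun j => ?_
    rw [Fintype.sum_prod_type]
    simp [LinearMap.sum_apply, Finsupp.single_apply, ite_smul, b.sum_repr]
  have hA : (fun g => L (A g)) =
      fun g => ∑ p : Fin (Module.finrank ℂ U) × Fin (Module.finrank ℂ U),
        b.coord p.1 (A g (b p.2)) * L ((b.coord p.2).smulRight (b p.1)) := by
    ext g
    conv_lhs => rw [hb (A g)]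
    simp only [map_sum, map_smul, smul_eq_mul]
  rw [hA]
  have hg : ContDiff ℂ n fun c : Fin (Module.finrank ℂ U) × Fin (Module.finrank ℂ U) → ℂ =>
      ∑ p, c p * L ((b.coord p.2).smulRight (b p.1)) := by
    refine ContDiff.sum fun i _ => ?_
    exact (contDiff_apply ℂ ℂ i).mul contDiff_const
  exact hg.contMDiff.comp (contMDiff_pi_space.2 fun p => h (b.coord p.1) (b p.2))

/-- The unipotent extension of a representation by the coboundary `g ↦ Φ(g) t - t`. -/
def Representation.coboundaryExtension {G : Type*} [Group G] {W : Type*} [AddCommGroup W]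
    [Module ℂ W] (Φ : Representation ℂ G W) (t : W) : G →* Module.End ℂ (W × ℂ) where
  toFun g := LinearMap.prod (Φ g ∘ₗ LinearMap.fst ℂ W ℂ +
    (LinearMap.snd ℂ W ℂ).smulRight (Φ g t - t)) (LinearMap.snd ℂ W ℂ)
  map_one' := by
    refine LinearMap.ext fun p => ?_
    simp
  map_mul' g h := by
    refine LinearMap.ext fun p => ?_
    simp [smul_sub]
    abel

variable {E : Type*} [NormedAddCommGroup E] [NormedSpace ℝ E]
  {K : Type*} [TopologicalSpace K] [ChartedSpace E K] [Group K]
  {G : Type w} [TopologicalSpace G] [ChartedSpace F G] [Group G] {ι : K →* G}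

/-- Two linear representations of the complexification with holomorphic matrix
coefficients agree if they agree on `K`. -/
theorem IsLieComplexification.eq_of_comp_eq (hι : IsLieComplexification E F ι)
    {U : Type*} [AddCommGroup U] [Module ℂ U] [FiniteDimensional ℂ U]
    {A B : G →* Module.End ℂ U}
    (hA : ∀ (l : U →ₗ[ℂ] ℂ) (x : U), ContMDiff 𝓘(ℂ, F) 𝓘(ℂ, ℂ) ω fun g => l (A g x))
    (hB : ∀ (l : U →ₗ[ℂ] ℂ) (x : U), ContMDiff 𝓘(ℂ, F) 𝓘(ℂ, ℂ) ω fun g => l (B g x))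
    (h : A.comp ι = B.comp ι) : A = B := by
  -- The universal property only tests Lie groups in the universe of `G`, so `GL(U)` is replaced by
  -- the units of an operator algebra in that universe.
  let J := ULift.{w} (Fin (Module.finrank ℂ U))
  let e : U ≃ₗ[ℂ] (J → ℂ) :=
    (Module.finBasis ℂ U).equivFun.trans (LinearEquiv.funCongrLeft ℂ ℂ Equiv.ulift)
  let Θ : Module.End ℂ U ≃ₐ[ℂ] ((J → ℂ) →L[ℂ] (J → ℂ)) :=
    (e.conjAlgEquiv ℂ).trans (Module.End.toContinuousLinearMap (J → ℂ))
  let T : (G →* Module.End ℂ U) → (G →* ((J → ℂ) →L[ℂ] (J → ℂ))ˣ) := fun A =>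
    (Units.map (Θ : Module.End ℂ U →* ((J → ℂ) →L[ℂ] (J → ℂ)))).comp A.toHomUnits
  have hT : ∀ A : G →* Module.End ℂ U,
      (∀ (l : U →ₗ[ℂ] ℂ) (x : U), ContMDiff 𝓘(ℂ, F) 𝓘(ℂ, ℂ) ω fun g => l (A g x)) →
      ContMDiff 𝓘(ℂ, F) 𝓘(ℂ, (J → ℂ) →L[ℂ] (J → ℂ)) ω (T A) := by
    intro A hA
    apply ContMDiff.of_comp_isOpenEmbedding Units.isOpenEmbedding_val
    exact contMDiff_of_forall_linear fun l =>
      contMDiff_linear_of_forall_coeff hA (l ∘ₗ Θ.toLinearMap)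
  have hρ : ContMDiff 𝓘(ℝ, E) 𝓘(ℝ, (J → ℂ) →L[ℂ] (J → ℂ)) ∞ ((T A).comp ι) :=
    ((hT A hA).restrictScalars_real.of_le le_top).comp hι.contMDiff
  have heq : (T B).comp ι = (T A).comp ι := by
    ext1 u
    refine Units.ext ?_
    change Θ (B (ι u)) = Θ (A (ι u))
    exact congrArg Θ (DFunLike.congr_fun h u).symm
  have huniq := (hι.existsUnique_lift _ _ _ hρ).unique ⟨hT A hA, rfl⟩ ⟨hT B hB, heq⟩
  ext1 g
  have := congrArg Units.val (DFunLike.congr_fun huniq g)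
  exact Θ.injective this

/-- Vectors fixed by `K` are fixed by its complexification. -/
theorem IsLieComplexification.apply_eq_self (hι : IsLieComplexification E F ι)
    {W : Type*} [AddCommGroup W] [Module ℂ W] [FiniteDimensional ℂ W] {Φ : Representation ℂ G W}
    (hΦ : ∀ (l : W →ₗ[ℂ] ℂ) (x : W), ContMDiff 𝓘(ℂ, F) 𝓘(ℂ, ℂ) ω fun g => l (Φ g x))
    {t : W} (ht : ∀ u, Φ (ι u) t = t) (g : G) : Φ g t = t := by
  have hcoeff : ∀ s (l : W × ℂ →ₗ[ℂ] ℂ) (x : W × ℂ),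
      ContMDiff 𝓘(ℂ, F) 𝓘(ℂ, ℂ) ω fun g => l (Φ.coboundaryExtension s g x) := by
    intro s l x
    have h : (fun g => l (Φ.coboundaryExtension s g x)) = fun g =>
        (l ∘ₗ LinearMap.inl ℂ W ℂ) (Φ g x.1) + (x.2 * (l ∘ₗ LinearMap.inl ℂ W ℂ) (Φ g s) +
          l (-(x.2 • s), x.2)) := by
      ext g
      have : Φ.coboundaryExtension s g x =
          (Φ g x.1, 0) + (x.2 • ((Φ g s, 0) : W × ℂ) + (-(x.2 • s), x.2)) := by
        simp [Representation.coboundaryExtension, sub_eq_add_neg]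
      rw [this, map_add, map_add, map_smul]
      rfl
    rw [h]
    have hg : ContDiff ℂ ω fun c : ℂ × ℂ => c.1 + (x.2 * c.2 + l (-(x.2 • s), x.2)) := by fun_prop
    exact hg.contMDiff.comp ((hΦ (l ∘ₗ LinearMap.inl ℂ W ℂ) x.1).prodMk_space
      (hΦ (l ∘ₗ LinearMap.inl ℂ W ℂ) s))
  -- Uniqueness of extensions concerns homomorphisms, so the function `g ↦ Φ g t - t` is encoded in
  -- one. On `K` it vanishes, hence the extensions for `t` and `0` agree there and therefore on `G`.
  have h := hι.eq_of_comp_eq (hcoeff t) (hcoeff 0) (by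
    ext1 u
    refine LinearMap.ext fun x => ?_
    simp [Representation.coboundaryExtension, ht])
  have h1 := congrArg Prod.fst (LinearMap.congr_fun (DFunLike.congr_fun h g) (0, 1))
  simpa [Representation.coboundaryExtension, sub_eq_zero] using h1

end HolomorphicCoefficients

/-! ### Tensor powers and the projection as an average over `K` -/

section TensorPowerRepresentation

open MeasureTheory

variable {V : Type*} [NormedAddCommGroup V] [InnerProductSpace ℂ V]

theorem HTensorPower.induction_on {k : ℕ} {P : HTensorPower V k → Prop} (t : HTensorPower V k)
    (smul_tprod : ∀ (c : ℂ) x, P (c • HTensorPower.tprod x)) (add : ∀ s t, P s → P t → P (s + t)) :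
    P t :=
  PiTensorProduct.induction_on (motive := P) t smul_tprod add

variable {G : Type*} [Group G] (φ : Representation ℂ G V)

theorem Representation.hTensorPower_tprod {k : ℕ} (g : G) (x : Fin k → V) :
    φ.hTensorPower k g (HTensorPower.tprod x) = HTensorPower.tprod fun i => φ g (x i) :=
  PiTensorProduct.map_tprod _ _

variable [FiniteDimensional ℂ V]

theorem HTensorPower.tprod_eq_sum {k : ℕ} (x : Fin k → V) : HTensorPower.tprod x =
    ∑ p, (∏ i, inner ℂ (stdOrthonormalBasis ℂ V (p i)) (x i)) • HTensorPower.stdBasis V k p := by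
  conv_lhs => rw [← (HTensorPower.stdBasis V k).sum_repr (HTensorPower.tprod x)]
  refine Finset.sum_congr rfl fun p _ => ?_
  congr 1
  refine (Basis.piTensorProduct_repr_tprod_apply _ x p).trans ?_
  simp [OrthonormalBasis.repr_apply_apply]

theorem Representation.inner_hTensorPower {k : ℕ} {g : G}
    (hg : ∀ x y, inner ℂ (φ g x) (φ g y) = inner ℂ x y) (s t : HTensorPower V k) :
    inner ℂ (φ.hTensorPower k g s) (φ.hTensorPower k g t) = inner ℂ s t := by
  induction s using HTensorPower.induction_on with
  | add s s' hs hs' => rw [map_add, inner_add_left, inner_add_left, hs, hs']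
  | smul_tprod c x =>
    induction t using HTensorPower.induction_on with
    | add t t' ht ht' => rw [map_add, inner_add_right, inner_add_right, ht, ht']
    | smul_tprod d y =>
      simp only [map_smul, inner_smul_left, inner_smul_right, φ.hTensorPower_tprod,
        HTensorPower.inner_tprod, hg]

/-- On elementary tensors the coefficients are polynomials in the matrix entries of `φ g`. -/
theorem contMDiff_linear_hTensorPower {F : Type*} [NormedAddCommGroup F] [NormedSpace ℂ F]
    [TopologicalSpace G] [ChartedSpace F G] {φ : Representation ℂ G V}
    (hφ : ContMDiff 𝓘(ℂ, F) 𝓘(ℂ, V →L[ℂ] V) ω φ.toEnd) (k : ℕ)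
    (l : HTensorPower V k →ₗ[ℂ] ℂ) (t : HTensorPower V k) :
    ContMDiff 𝓘(ℂ, F) 𝓘(ℂ, ℂ) ω fun g => l (φ.hTensorPower k g t) := by
  induction t using HTensorPower.induction_on with
  | add s t hs ht =>
    simp only [map_add]
    exact (contDiff_add (𝕜 := ℂ) (F := ℂ)).contMDiff.comp (hs.prodMk_space ht)
  | smul_tprod c x =>
    have h : (fun g => l (φ.hTensorPower k g (c • HTensorPower.tprod x))) =
        (fun A : V →L[ℂ] V => c * ∑ p, (∏ i, inner ℂ (stdOrthonormalBasis ℂ V (p i)) (A (x i))) *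
          l (HTensorPower.stdBasis V k p)) ∘ φ.toEnd := by
      ext g
      rw [map_smul, map_smul, φ.hTensorPower_tprod, HTensorPower.tprod_eq_sum, map_sum]
      simp only [map_smul, smul_eq_mul]
      rfl
    rw [h]
    refine ContMDiff.comp (ContDiff.contMDiff ?_) hφ
    refine contDiff_const.mul (ContDiff.sum fun p _ => ContDiff.mul ?_ contDiff_const)
    refine contDiff_prod fun i _ => ?_
    exact ((innerSL ℂ (stdOrthonormalBasis ℂ V (p i))).comp
      (ContinuousLinearMap.apply ℂ V (x i))).contDiff

theorem continuous_hTensorPower_pow {K : Type*} [TopologicalSpace K] [Group K]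
    {π : Representation ℂ K V} {v : V} (h : Continuous fun u => π u v) (k : ℕ) :
    Continuous fun u => π.hTensorPower k u (HTensorPower.pow v k) := by
  have h1 : (fun u => π.hTensorPower k u (HTensorPower.pow v k)) = fun u =>
      ∑ p, (∏ i, inner ℂ (stdOrthonormalBasis ℂ V (p i)) (π u v)) • HTensorPower.stdBasis V k p := by
    ext u
    exact (π.hTensorPower_tprod u _).trans (HTensorPower.tprod_eq_sum _)
  rw [h1]
  refine continuous_finsetSum _ fun p _ => Continuous.smul (M := ℂ) ?_ continuous_const
  exact continuous_finsetProd _ fun i _ => continuous_const.inner h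

/-- The squared norm of the projection of `v^{⊗k}` onto the invariants is the average of the `k`-th
power of the matrix coefficient of `v` over `K`, when the invariants of `K` and `G` agree. -/
theorem norm_invariantProj_pow_sq {K : Type*} [TopologicalSpace K] [Group K] [IsTopologicalGroup K]
    [CompactSpace K] [MeasurableSpace K] [BorelSpace K] (P : Measure K) [IsProbabilityMeasure P]
    [P.IsMulLeftInvariant] {φ : Representation ℂ G V} {ι : K →* G} {v : V}
    (hcont : Continuous fun u => φ (ι u) v)
    (hK : ∀ (u : K) (x y : V), inner ℂ (φ (ι u) x) (φ (ι u) y) = inner ℂ x y) (k : ℕ)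
    (hinv : ∀ t : HTensorPower V k, (∀ u, φ.hTensorPower k (ι u) t = t) →
      ∀ g, φ.hTensorPower k g t = t) :
    ((‖φ.invariantProj k (HTensorPower.pow v k)‖ ^ 2 : ℝ) : ℂ) =
      ∫ u, inner ℂ v (φ (ι u) v) ^ k ∂P := by
  set t := HTensorPower.pow v k with ht
  set f : K → HTensorPower V k := fun u => φ.hTensorPower k (ι u) t with hf
  have hfc : Continuous f := continuous_hTensorPower_pow (π := φ.comp ι) hcont k
  have hfint : Integrable f P := by
    have := hfc.stronglyMeasurable (β := HTensorPower V k)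
    obtain ⟨C, hC⟩ := (isCompact_range hfc).isBounded.exists_norm_le
    exact Integrable.of_bound this.aestronglyMeasurable C (ae_of_all _ fun u => hC _ ⟨u, rfl⟩)
  -- The average is fixed by `K` through left invariance of `P`, hence by `G`. Unitarity gives every
  -- `f u` the same inner product with an invariant vector as `t`, so `t` minus the average is
  -- orthogonal to the invariants.
  have havg : φ.invariantProj k t = ∫ u, f u ∂P := by
    refine Submodule.eq_starProjection_of_mem_of_inner_eq_zero ?_ ?_
    · rw [Representation.mem_invariants]
      refine hinv _ fun u => ?_
      have h1 := (LinearMap.toContinuousLinearMap (φ.hTensorPower k (ι u))).integral_comp_comm hfint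
      rw [LinearMap.coe_toContinuousLinearMap'] at h1
      rw [← h1]
      have h2 : ∀ s, φ.hTensorPower k (ι u) (f s) = f (u * s) := by
        intro s
        simp only [hf, map_mul, Module.End.mul_apply]
      simp only [h2]
      exact integral_mul_left_eq_self f u
    · intro s hs
      rw [Representation.mem_invariants] at hs
      rw [inner_sub_left, ← inner_conj_symm (∫ u, f u ∂P), ← integral_inner hfint]
      have h1 : ∀ u, inner ℂ s (f u) = inner ℂ s t := by
        intro u
        conv_lhs => rw [← hs (ι u)]
        exact φ.inner_hTensorPower (hK u) s t
      simp [h1]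
  have h1 : ((‖φ.invariantProj k t‖ ^ 2 : ℝ) : ℂ) = inner ℂ t (φ.invariantProj k t) := by
    have h2 := Submodule.starProjection_inner_eq_zero (K := (φ.hTensorPower k).invariants) t
      (φ.invariantProj k t) (Submodule.starProjection_apply_mem _ t)
    rw [inner_sub_left, sub_eq_zero] at h2
    rw [h2]
    change _ = inner ℂ (φ.invariantProj k t) (φ.invariantProj k t)
    rw [inner_self_eq_norm_sq_to_K]
    norm_cast
  rw [h1, havg, ← integral_inner hfint]
  refine integral_congr_ae (ae_of_all _ fun u => ?_)
  simp only [hf, ht, HTensorPower.pow, φ.hTensorPower_tprod, HTensorPower.inner_tprod]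
  simp

end TensorPowerRepresentation

/-! ### From the moment map to the Lie algebra of `K` -/

section VanishingMomentMap

variable {E : Type*} [NormedAddCommGroup E] [NormedSpace ℝ E]
  {K : Type*} [TopologicalSpace K] [ChartedSpace E K] [Group K]
  {F : Type*} [NormedAddCommGroup F] [NormedSpace ℂ F]
  {G : Type*} [TopologicalSpace G] [ChartedSpace F G] [Group G] {ι : K →* G}
  {V : Type*} [NormedAddCommGroup V] [InnerProductSpace ℂ V] [FiniteDimensional ℂ V]
  {φ : Representation ℂ G V}

theorem realInfinitesimal_comp (hι : MDifferentiableAt 𝓘(ℝ, E) 𝓘(ℝ, F) ι 1)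
    (hφ : MDifferentiableAt 𝓘(ℂ, F) 𝓘(ℂ, V →L[ℂ] V) φ.toEnd 1) (X : E) :
    Representation.realInfinitesimal E (φ.comp ι : Representation ℂ K V) X =
      φ.infinitesimal F (lieDifferential E F ι X) := by
  have key : ∀ g, ι 1 = g → MDifferentiableAt 𝓘(ℂ, F) 𝓘(ℂ, V →L[ℂ] V) φ.toEnd g →
      HasMFDerivAt 𝓘(ℝ, E) 𝓘(ℝ, V →L[ℂ] V) (φ.toEnd ∘ ι) 1
        (((mfderiv 𝓘(ℂ, F) 𝓘(ℂ, V →L[ℂ] V) φ.toEnd g :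
          F →L[ℂ] (V →L[ℂ] V)).restrictScalars ℝ).comp
          (mfderiv 𝓘(ℝ, E) 𝓘(ℝ, F) ι 1 : E →L[ℝ] F)) := by
    rintro _ rfl h
    exact HasMFDerivAt.comp (1 : K) (h.hasMFDerivAt.restrictScalars_real) hι.hasMFDerivAt
  have h := (key 1 (map_one ι) hφ).mfderiv
  exact DFunLike.congr_fun h X

/-- If the moment map vanishes at `v`, the whole Lie algebra of `K` maps `v` into `v^⊥`. -/
theorem inner_realInfinitesimal_eq_zero_of_momentMap [LieGroup 𝓘(ℝ, E) ∞ K] [T2Space K]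
    [CompleteSpace E]
    (hι : ContMDiff 𝓘(ℝ, E) 𝓘(ℝ, F) ∞ ι)
    (hφ : ContMDiff 𝓘(ℂ, F) 𝓘(ℂ, V →L[ℂ] V) ω φ.toEnd)
    (hK : ∀ (u : K) (x y : V), inner ℂ (φ (ι u) x) (φ (ι u) y) = inner ℂ x y)
    {v : V} (hv : v ≠ 0) (hμ : momentMap E F ι φ v = 0) (X : E) :
    inner ℂ v (Representation.realInfinitesimal E (φ.comp ι : Representation ℂ K V) X v) = 0 := by
  set π : Representation ℂ K V := φ.comp ι with hπ'
  have hπ : ContMDiff 𝓘(ℝ, E) 𝓘(ℝ, V →L[ℂ] V) ∞ π.toEnd :=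
    (hφ.restrictScalars_real.of_le le_top).comp hι
  have hX := realInfinitesimal_comp (hι.mdifferentiable (by simp) 1)
    (hφ.mdifferentiable (by simp) 1) X
  -- The real part vanishes because `Φ(X)` is skew-Hermitian. The imaginary part is, up to sign and
  -- the factor `‖v‖²`, the moment map at `i X`.
  apply Complex.ext
  · have h1 := inner_realInfinitesimal_left (hπ.mdifferentiable (by simp)) hK X v v
    rw [← inner_conj_symm] at h1
    have := congrArg Complex.re h1
    simp only [Complex.conj_re, Complex.neg_re] at this
    simp only [Complex.zero_re]
    linarith
  · have h1 := LinearMap.congr_fun hμ ⟨Complex.I • lieDifferential E F ι X, X, rfl⟩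
    have h2 : (inner ℂ v (φ.infinitesimal F (Complex.I • lieDifferential E F ι X) v)).re /
      ‖v‖ ^ 2 = 0 := h1
    rw [div_eq_zero_iff, or_iff_left (by simpa using hv), map_smul, ← hX, smul_apply,
      inner_smul_right] at h2
    simpa using h2

end VanishingMomentMap

/-! ### Asymptotics of the averaged matrix coefficient -/

section OrbitVolume

open MeasureTheory

variable {E : Type*} [NormedAddCommGroup E] [NormedSpace ℝ E] [FiniteDimensional ℝ E]
  {K : Type*} [TopologicalSpace K] [ChartedSpace E K] [Group K] [LieGroup 𝓘(ℝ, E) ∞ K]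
  [T2Space K] [CompactSpace K]
  {V : Type*} [NormedAddCommGroup V] [InnerProductSpace ℂ V] [FiniteDimensional ℂ V]
  {π : Representation ℂ K V}

theorem exists_tendsto_pow_mul_integral_inner_pow
    [IsTopologicalGroup K] [MeasurableSpace K] [BorelSpace K] (P : Measure K)
    [IsProbabilityMeasure P] [P.IsMulLeftInvariant]
    (hπ : ContMDiff 𝓘(ℝ, E) 𝓘(ℝ, V →L[ℂ] V) ∞ π.toEnd)
    (hK : ∀ (u : K) (x y : V), inner ℂ (π u x) (π u y) = inner ℂ x y) {v : V} (hv : ‖v‖ = 1)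
    (hμ : ∀ X, inner ℂ v (π.realInfinitesimal E X v) = 0) :
    ∃ m : ℕ, 0 < m ∧ ∃ L : ℝ, 0 < L ∧ Tendsto (fun k : ℕ =>
      (((k : ℝ) ^ ((Module.finrank ℝ (π.orbitDifferential E v).range : ℝ) / 2) : ℝ) : ℂ) *
        ∫ u, (inner ℂ v (π u v)) ^ (m * k) ∂P) atTop (𝓝 (L : ℂ)) := by
  have hcompl : CompleteSpace E := FiniteDimensional.complete ℝ E
  have hproper : ProperSpace V := FiniteDimensional.proper ℂ V
  have hVR : FiniteDimensional ℝ V := FiniteDimensional.complexToReal V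
  have hcont : Continuous fun u => π u v :=
    (ContinuousLinearMap.apply ℂ V v).continuous.comp hπ.continuous
  obtain ⟨α, hα0, hαO, hα, hαd, hαr, hcov⟩ := exists_orbit_parametrization hπ hK hμ
  have him : ∀ ε > 0, ∃ δ > 0, ∀ u : K, dist (π u v) v ≤ δ →
      |(inner ℂ v (π u v)).im| ≤ ε * dist (π u v) v ^ 2 := by
    intro ε hε
    have hT : ∀ x y : (π.orbitDifferential E v).range, (inner ℂ (x : V) (y : V)).im = 0 := by
      rintro ⟨_, X, rfl⟩ ⟨_, Y, rfl⟩
      exact im_inner_realInfinitesimal_eq_zero (hπ.mdifferentiable (by simp)) hK hμ X Y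
    obtain ⟨δ, hδ, h⟩ := exists_abs_im_inner_le (hα.of_le (by simp)) hαd hαr hT hε
    obtain ⟨r, hr, h'⟩ := hcov δ hδ
    refine ⟨r, hr, fun u hu => ?_⟩
    obtain ⟨x, hx, hxu⟩ := h' u hu
    rw [← hxu, dist_eq_norm]
    simpa only [hα0] using h x hx
  borelize V
  let := π.toMulAction
  have hisom : IsIsometricSMul K V := ⟨fun u => Isometry.of_dist_eq (dist_apply_apply hK u)⟩
  obtain ⟨c, hc, hF⟩ := exists_tendsto_measure_dist_smul_le P (v := v) hcont hα0
    (fun x => hαO x)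
    (fun η hη => exists_abs_dist_sub_dist_le (by
      rw [← hαd]
      exact hα.contDiffAt.hasStrictFDerivAt (by simp)) hη)
    (fun δ hδ => by
      obtain ⟨r, hr, h⟩ := hcov δ hδ
      refine ⟨r, hr, ?_⟩
      rintro _ ⟨⟨u, rfl⟩, hu⟩
      obtain ⟨x, hx, hxu⟩ := h u hu
      exact ⟨x, by simpa using hx, hxu⟩)
  exact exists_tendsto_integral_inner_pow hK hv him P hcont hc hF

end OrbitVolume

/-! ### Invariant probability measure -/

section HaarProbability

open MeasureTheory

theorem exists_isProbabilityMeasure_isMulLeftInvariant (K : Type*) [TopologicalSpace K] [Group K]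
    [IsTopologicalGroup K] [CompactSpace K] [MeasurableSpace K] [BorelSpace K] :
    ∃ P : Measure K, IsProbabilityMeasure P ∧ P.IsMulLeftInvariant :=
  ⟨Measure.haarMeasure ⊤, ⟨Measure.haarMeasure_self⟩, inferInstance⟩

end HaarProbability
end

/-! ### The main theorem -/

theorem mainTheorem2
    -- a compact connected Lie group `K`
    {E : Type*} [NormedAddCommGroup E] [NormedSpace ℝ E] [FiniteDimensional ℝ E]
    {K : Type*} [TopologicalSpace K] [ChartedSpace E K] [Group K] [LieGroup 𝓘(ℝ, E) ∞ K]
    [T2Space K] [CompactSpace K] [ConnectedSpace K]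
    -- its complexification `G`
    {F : Type*} [NormedAddCommGroup F] [NormedSpace ℂ F] [FiniteDimensional ℂ F]
    {G : Type*} [TopologicalSpace G] [ChartedSpace F G] [Group G] [LieGroup 𝓘(ℂ, F) ω G]
    [T2Space G] (ι : K →* G) (hι : IsLieComplexification E F ι)
    -- a finite-dimensional representation of `G`, with a `K`-invariant inner product
    {V : Type*} [NormedAddCommGroup V] [InnerProductSpace ℂ V] [FiniteDimensional ℂ V]
    (φ : Representation ℂ G V)
    (hφ : ContMDiff 𝓘(ℂ, F) 𝓘(ℂ, V →L[ℂ] V) ω φ.toEnd)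
    (hK : ∀ (u : K) (x y : V), inner ℂ (φ (ι u) x) (φ (ι u) y) = inner ℂ x y)
    (v : V) (hv : ‖v‖ = 1) (hμ : momentMap E F ι φ v = 0) :
    ∃ m : ℕ, 0 < m ∧ ∃ L : ℝ, 0 < L ∧
      Tendsto (fun k : ℕ =>
        ((m * k : ℕ) : ℝ) ^ (((Module.finrank ℝ E : ℝ) -
            (Subgroup.lieDim E (Representation.lineStabilizer (φ.comp ι) v) : ℝ)) / 2) *
          ‖φ.invariantProj (m * k) (HTensorPower.pow v (m * k))‖ ^ 2)
        atTop (𝓝 L) := by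
  have hcompl : CompleteSpace E := FiniteDimensional.complete ℝ E
  have hgroup : IsTopologicalGroup K := topologicalGroup_of_lieGroup 𝓘(ℝ, E) ∞
  borelize K
  obtain ⟨P, hP, hP'⟩ := exists_isProbabilityMeasure_isMulLeftInvariant K
  let π : Representation ℂ K V := φ.comp ι
  have hπ : ContMDiff 𝓘(ℝ, E) 𝓘(ℝ, V →L[ℂ] V) ∞ π.toEnd :=
    (hφ.restrictScalars_real.of_le le_top).comp hι.contMDiff
  have hcont : Continuous fun u => π u v :=
    (ContinuousLinearMap.apply ℂ V v).continuous.comp hπ.continuous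
  have hv0 : v ≠ 0 := norm_ne_zero_iff.1 (by rw [hv]; exact one_ne_zero)
  have hμ' : ∀ X, inner ℂ v (π.realInfinitesimal E X v) = 0 :=
    inner_realInfinitesimal_eq_zero_of_momentMap hι.contMDiff hφ hK hv0 hμ
  obtain ⟨m, hm, L, hL, hlim⟩ := exists_tendsto_pow_mul_integral_inner_pow P hπ hK hv hμ'
  set d : ℝ := (Module.finrank ℝ (π.orbitDifferential E v).range : ℝ) with hd
  -- Rank–nullity for `X ↦ Φ(X) v`, whose kernel is the Lie algebra of the line stabilizer.
  have hdim : (Module.finrank ℝ E : ℝ) - Subgroup.lieDim E (π.lineStabilizer v) = d := by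
    rw [lieDim_lineStabilizer (hπ.mdifferentiable (by simp)) hv hμ', hd, sub_eq_iff_eq_add]
    exact_mod_cast (π.orbitDifferential E v).finrank_range_add_finrank_ker.symm
  -- The factor `m^{d/2}` accounts for the normalization by `(m k)^{d/2}` instead of `k^{d/2}`.
  refine ⟨m, hm, (m : ℝ) ^ (d / 2) * L, by positivity, ?_⟩
  have hre := ((Complex.continuous_re.tendsto _).comp hlim).const_mul ((m : ℝ) ^ (d / 2))
  rw [Complex.ofReal_re] at hre
  refine hre.congr fun k => ?_
  have hnorm := norm_invariantProj_pow_sq P hcont hK (m * k) fun t ht g =>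
    hι.apply_eq_self (contMDiff_linear_hTensorPower hφ (m * k)) ht g
  change _ = _ ^ ((_ - ((Subgroup.lieDim E (π.lineStabilizer v) : ℕ) : ℝ)) / 2) * _
  rw [hdim, Nat.cast_mul, Real.mul_rpow (Nat.cast_nonneg m) (Nat.cast_nonneg k), mul_assoc,
    Function.comp_apply, Complex.re_ofReal_mul]
  congr 2
  change (∫ u, inner ℂ v (φ (ι u) v) ^ (m * k) ∂P).re = _
  rw [← hnorm, Complex.ofReal_re]
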